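/- An instance of \textsc{Coalitional Manipulation} for the maximin voting rule consists of a set $\mathcal{C}$ of $m$ candidates, a distinguished candidate $c\in\mathcal{C}$, the votes (linear orders over $\mathcal{C}$) of the non-manipulators, and a nonempty set $M$ of manipulators; the question is whether the manipulators can cast votes such that $c$ is the unique maximin winner of the election formed by all votes. Here $D(x,y)$ is the number of voters who prefer $x$ to $y$ minus the number of voters who prefer $y$ to $x$, the maximin score of $x$ is $\min_{y\neq x}D(x,y)$, and the winners are the candidates with maximum maximin score. (If $m=1$, the only candidate wins.) For every polynomial $p$, the problem \textsc{Coalitional Manipulation} for maximin, restricted to instances with $|M|\le p(m)$ and parameterized by the number $m$ of candidates, admits a polynomial kernel: there is an algorithm that, given $(x,k)\in\{0,1\}^*\times\mathbb{N}$, computes in time polynomial in $|x|+k$ a pair $(x',k')$ such that $(x,k)$ is a yes-instance if and only if $(x',k')$ is one, and $|x'|,k'\le g(k)$ for a computable function $g$ that is bounded by a polynomial. (Here $(x,k)$ is a yes-instance if $x$ encodes a positive instance with $m=k$ candidates and $|M|\le p(m)$.) Moreover, the kernel has $O(m^2|M|)$ voters: there is an absolute constant $C$, independent of $p$, such that on every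 (encoded) instance with $m$ candidates and a set $M$ of manipulators, $|M|\le p(m)$, the algorithm outputs an (encoded) instance of the same restricted problem with at most $m$ candidates, at most $|M|$ manipulators, and at most $C\,m^2\,|M|$ voters in total, manipulators included. -/

import Mathlib

/-! ### Elections and the maximin voting rule -/

/-- A vote: a linear order over the candidates `0, …, m - 1`, given by the bijection that sends a
rank to the candidate placed at that rank (rank `0` is the most preferred one). -/
abbrev Vote (m : ℕ) : Type := Fin m ≃ Fin m

/-- The vote `v` prefers candidate `a` to candidate `b`. -/
def Vote.Prefers {m : ℕ} (v : Vote m) (a b : Fin m) : Prop :=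
  v.symm a < v.symm b

instance {m : ℕ} (v : Vote m) (a b : Fin m) : Decidable (v.Prefers a b) :=
  inferInstanceAs (Decidable (v.symm a < v.symm b))

/-- A preference profile: the votes of finitely many voters. -/
abbrev Profile (m : ℕ) : Type := List (Vote m)

namespace Profile

/-- The number `N(a, b)` of voters who prefer `a` to `b`. -/
def support {m : ℕ} (P : Profile m) (a b : Fin m) : ℕ :=
  P.countP fun v => decide (v.Prefers a b)

/-- The weight `D(a, b) = N(a, b) - N(b, a)` of the edge `(a, b)` of the weighted majority graph. -/
def margin {m : ℕ} (P : Profile m) (a b : Fin m) : ℤ :=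
  (P.support a b : ℤ) - (P.support b a : ℤ)

/-- The maximin score `min_{b ≠ a} D(a, b)`. The minimum is taken in `WithTop ℤ`; it is an integer
as soon as there are two candidates, and `⊤` if `a` is the only candidate. -/
def maximinScore {m : ℕ} (P : Profile m) (a : Fin m) : WithTop ℤ :=
  (Finset.univ.erase a).inf fun b => (P.margin a b : WithTop ℤ)

/-- The maximin winners: the candidates with maximum maximin score. -/
def maximinWinners {m : ℕ} (P : Profile m) : Set (Fin m) :=
  {a | ∀ b, P.maximinScore b ≤ P.maximinScore a}

end Profile

/-! ### The coalitional manipulation problem for maximin -/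

/-- An instance of coalitional manipulation: `m` candidates, a distinguished candidate, the
votes of the non-manipulators, and the number of manipulators (at least one). -/
structure CMInstance where
  /-- number of candidates -/
  m : ℕ
  /-- distinguished candidate -/
  c : Fin m
  /-- votes of the non-manipulators -/
  votes : Profile m
  /-- number of manipulators -/
  manip : ℕ
  manip_pos : 0 < manip

namespace CMInstance

/-- The manipulators can vote in such a way that the distinguished candidate is the unique
maximin winner of the resulting election. -/
def IsYes (I : CMInstance) : Prop :=
  ∃ W : Profile I.m, W.length = I.manip ∧ (I.votes ++ W).maximinWinners = {I.c}

/-- The total number of voters. -/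
def voters (I : CMInstance) : ℕ := I.votes.length + I.manip

/-- The self-delimiting unary code `1…10` of a natural number. -/
def encodeNat (n : ℕ) : List Bool := List.replicate n true ++ [false]

/-- A vote is written as the list of its candidates, from the most to the least preferred one. -/
def encodeVote {m : ℕ} (v : Vote m) : List Bool :=
  (List.ofFn fun r : Fin m => encodeNat (v r)).flatten

/-- The bit string that represents an instance: the number of candidates, the distinguished
candidate, the number of manipulators, and the list of all non-manipulators' votes. -/
def encode (I : CMInstance) : List Bool :=
  encodeNat I.m ++ encodeNat I.c ++ encodeNat I.manip ++ (I.votes.map encodeVote).flatten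

end CMInstance

/-! ### Parameterized problems and kernelization -/

/-- A parameterized problem over the alphabet `Γ`. -/
abbrev ParameterizedProblem (Γ : Type) : Type := Set (List Γ × ℕ)

/-- The input (or output) string of a machine for the pair `(x, k)`: the word `x` followed by `k`
copies of an extra symbol. Its length is `|x| + k`. -/
def encodePair {Γ : Type} (y : List Γ × ℕ) : List (Option Γ) :=
  y.1.map some ++ List.replicate y.2 none

/-- `f` can be computed by a Turing machine in time polynomial in `|x| + k`. -/
def IsPolyTime {Γ : Type} (f : List Γ × ℕ → List Γ × ℕ) : Prop :=
  Nonempty (Turing.TM2ComputableInPolyTime encodePair encodePair f)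

/-- `f` is a kernelization algorithm of size `g` for the parameterized problem `L`. -/
structure IsKernelization {Γ : Type} [Fintype Γ] (L : ParameterizedProblem Γ)
    (f : List Γ × ℕ → List Γ × ℕ) (g : ℕ → ℕ) : Prop where
  polyTime : IsPolyTime f
  equivalent : ∀ y, y ∈ L ↔ f y ∈ L
  computable_size : Computable g
  length_le : ∀ y, (f y).1.length ≤ g y.2
  param_le : ∀ y, (f y).2 ≤ g y.2

/-- `f` is a kernelization algorithm for `L` whose size is bounded by a polynomial in the
parameter. -/
def IsPolynomialKernelization {Γ : Type} [Fintype Γ] (L : ParameterizedProblem Γ)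
    (f : List Γ × ℕ → List Γ × ℕ) : Prop :=
  ∃ g : ℕ → ℕ, IsKernelization L f g ∧ ∃ q : Polynomial ℕ, ∀ k, g k ≤ q.eval k

/-- Coalitional manipulation for maximin, parameterized by the number `m` of candidates and
restricted to instances with at most `p m` manipulators. -/
def MaximinCM (p : Polynomial ℕ) : ParameterizedProblem Bool :=
  {y | ∃ I : CMInstance, y = (I.encode, I.m) ∧ I.manip ≤ p.eval I.m ∧ I.IsYes}

/-! ### A structured programming language on top of `TM2` machines -/

namespace StackProg

/-! Correctness. Manipulators may as well rank `c` first: this raises every margin of `c` by `|M|`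
and raises no margin of another candidate (`Profile.margin_raise_le`). So if `c` has score `s` among
the non-manipulators, the question is whether votes `W` exist such that each `x ≠ c` has some `y`
with `D(x,y) + D_W(x,y) < s + |M|` (`isYes_iff_of_score`). If `s > -|M|`, ranking `c` first already
wins, and the kernel needs no non-manipulators.

Otherwise put `s = -w` with `w ≥ |M|`. Since `|D_W(x,y)| ≤ |M|`, a margin matters only through its
distance from `s`: it is irrelevant how far it lies below `s`, or how far beyond `s + 2|M|`. Hence
`w` can be replaced by `w' = min w (2|M|)` and the margins truncated accordingly. The truncation
must keep the margins antisymmetric (`excess_add_excess`), the inequalities above (`excess_lt_iff`)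
and the role of the score of `c` (`excess_self`, `one_le_excess`). All new margins have the parity
of `w'` and absolute value `O(|M|)`, so McGarvey's construction realizes them: a pair of votes for
each two units of margin, plus a single fixed vote if `w'` is odd (`lmargin_reducedVotes_eq`). This
takes `O(m ^ 2 * |M|)` votes.

Running time. A small structured language is compiled to `TM2` machines with exact step counts
(`Exec.simulate`). Data are coded as binary trees on one stack, and `Feasible` functions are those
that a program computes in polynomial time, replacing argument by value and leaving the rest of the
stacks alone. This class is closed under composition, pairing, branching and folds whose
intermediate results stay polynomially small (`Feasible.foldl`). The whole reduction is written with
list and number operations derived from these, so `fun_prop` proves it feasible. Strings that code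
no admissible instance are recognized by `valid` and sent to a fixed non-instance. -/

/-- The stacks of the machines: input/output, main, stash and counter. -/
inductive Stk
  | io | main | stash | ctr
  deriving DecidableEq

instance : Fintype Stk where
  elems := {.io, .main, .stash, .ctr}
  complete k := by cases k <;> decide

/-- The alphabet of all stacks; `none` serves as a separator. -/
abbrev Sym : Type := Option Bool

/-- The register holds the result of the last `pop`. -/
abbrev Reg : Type := Option Sym

abbrev Stacks : Type := Stk → List Sym

/-- Structured programs that work on the stacks. -/
inductive Cmd
  | skip
  | push (k : Stk) (f : Reg → Sym)
  | pop (k : Stk)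
  | seq (c d : Cmd)
  | ite (p : Reg → Bool) (c d : Cmd)
  | loop (p : Reg → Bool) (c : Cmd)

infixr:60 " ;; " => Cmd.seq

/-- `Exec c v W n v' W'`: started with register `v` and stacks `W`, the program `c` stops after
`n` steps with register `v'` and stacks `W'`. -/
inductive Exec : Cmd → Reg → Stacks → ℕ → Reg → Stacks → Prop
  | skip {v W} : Exec .skip v W 1 v W
  | push {k : Stk} {f : Reg → Sym} {v : Reg} {W W' : Stacks} (h : Function.update W k (f v :: W k) = W') : Exec (.push k f) v W 1 v W'
  | pop {k : Stk} {v v' : Reg} {W W' : Stacks} (hv : (W k).head? = v') (h : Function.update W k (W k).tail = W') :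
      Exec (.pop k) v W 1 v' W'
  | seq {c d v W n v₁ W₁ m v₂ W₂} (h₁ : Exec c v W n v₁ W₁) (h₂ : Exec d v₁ W₁ m v₂ W₂) :
      Exec (.seq c d) v W (n + m) v₂ W₂
  | ite_true {p c d v W n v₁ W₁} (hp : p v = true) (h : Exec c v W n v₁ W₁) :
      Exec (.ite p c d) v W (n + 1) v₁ W₁
  | ite_false {p c d v W n v₁ W₁} (hp : p v = false) (h : Exec d v W n v₁ W₁) :
      Exec (.ite p c d) v W (n + 1) v₁ W₁
  | loop_true {p c v W n v₁ W₁ m v₂ W₂} (hp : p v = true) (h₁ : Exec c v W n v₁ W₁)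
      (h₂ : Exec (.loop p c) v₁ W₁ m v₂ W₂) : Exec (.loop p c) v W (n + m + 1) v₂ W₂
  | loop_false {p c v W} (hp : p v = false) : Exec (.loop p c) v W 1 v W

/-- The labels of the machine for a program. -/
def Lab : Cmd → Type
  | .skip => Unit
  | .push _ _ => Unit
  | .pop _ => Unit
  | .seq c d => Lab c ⊕ Lab d
  | .ite _ c d => Option (Lab c ⊕ Lab d)
  | .loop _ c => Option (Lab c)

instance Lab.fintype : (c : Cmd) → Fintype (Lab c)
  | .skip => inferInstanceAs (Fintype Unit)
  | .push _ _ => inferInstanceAs (Fintype Unit)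
  | .pop _ => inferInstanceAs (Fintype Unit)
  | .seq c d =>
    letI := Lab.fintype c
    letI := Lab.fintype d
    inferInstanceAs (Fintype (Lab c ⊕ Lab d))
  | .ite _ c d =>
    letI := Lab.fintype c
    letI := Lab.fintype d
    inferInstanceAs (Fintype (Option (Lab c ⊕ Lab d)))
  | .loop _ c =>
    letI := Lab.fintype c
    inferInstanceAs (Fintype (Option (Lab c)))

/-- The label at which a program starts. -/
def start : (c : Cmd) → Lab c
  | .skip => ()
  | .push _ _ => ()
  | .pop _ => ()
  | .seq c _ => .inl (start c)
  | .ite _ _ _ => none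
  | .loop _ _ => none

abbrev MStmt (Λ : Type) : Type := Turing.TM2.Stmt (fun _ : Stk => Sym) Λ Reg

open Turing.TM2.Stmt in
/-- The translation of a program into the statements of a machine, where `emb` embeds the labels
of the program into those of the machine and `q` is what remains to be done afterwards. -/
def trans : (c : Cmd) → {Λ : Type} → (Lab c → Λ) → MStmt Λ → Lab c → MStmt Λ
  | .skip, _, _, q, _ => q
  | .push k f, _, _, q, _ => push k f q
  | .pop k, _, _, q, _ => pop k (fun _ x => x) q
  | .seq _ d, _, emb, _, .inl l => trans _ (fun l => emb (.inl l)) (goto fun _ => emb (.inr (start d))) l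
  | .seq _ _, _, emb, q, .inr l => trans _ (fun l => emb (.inr l)) q l
  | .ite p c d, _, emb, _, none =>
    branch p (goto fun _ => emb (some (.inl (start c)))) (goto fun _ => emb (some (.inr (start d))))
  | .ite _ _ _, _, emb, q, some (.inl l) => trans _ (fun l => emb (some (.inl l))) q l
  | .ite _ _ _, _, emb, q, some (.inr l) => trans _ (fun l => emb (some (.inr l))) q l
  | .loop p c, _, emb, q, none => branch p (goto fun _ => emb (some (start c))) q
  | .loop _ _, _, emb, _, some l =>
    trans _ (fun l => emb (some l)) (goto fun _ => emb none) l

open Turing in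
-- The continuation `q` runs within the same machine step as the last instruction of `c`, so the
-- count in `Exec` is exactly the number of machine steps. The embedding and the continuation are
-- arbitrary because the induction meets `c` inside larger programs.
theorem Exec.simulate {c : Cmd} {v : Reg} {W : Stacks} {n : ℕ} {v' : Reg} {W' : Stacks}
    (h : Exec c v W n v' W') :
    ∀ {Λ : Type} (M : Λ → MStmt Λ) (emb : Lab c → Λ) (q : MStmt Λ),
      (∀ l, M (emb l) = trans c emb q l) →
      (flip bind (TM2.step M))^[n] (some ⟨some (emb (start c)), v, W⟩) =
        some (TM2.stepAux q v' W') := by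
  have one : ∀ {Λ : Type} (M : Λ → MStmt Λ) (l : Λ) (v : Reg) (W : Stacks),
      (flip bind (TM2.step M))^[1] (some ⟨some l, v, W⟩) = some (TM2.stepAux (M l) v W) :=
    fun _ _ _ _ => rfl
  induction h with
  | skip =>
    intro Λ M emb q hM
    rw [one, hM]; rfl
  | push h =>
    intro Λ M emb q hM
    rw [one, hM, ← h]; rfl
  | pop hv h =>
    intro Λ M emb q hM
    rw [one, hM, ← h, ← hv]; rfl
  | @seq c d v W n v₁ W₁ m v₂ W₂ _ _ ih₁ ih₂ =>
    intro Λ M emb q hM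
    rw [Nat.add_comm, Function.iterate_add_apply]
    have e₁ := ih₁ M (fun l => emb (.inl l)) (.goto fun _ => emb (.inr (start d)))
      (fun l => hM (Sum.inl l))
    have e₂ := ih₂ M (fun l => emb (.inr l)) q (fun l => hM (Sum.inr l))
    exact (congrArg _ e₁).trans e₂
  | @ite_true p c d v W n v₁ W₁ hp _ ih =>
    intro Λ M emb q hM
    rw [Function.iterate_add_apply, one, hM]
    simp only [start, trans, TM2.stepAux, hp, cond_true]
    exact ih M (fun l => emb (some (.inl l))) q (fun l => hM (some (Sum.inl l)))
  | @ite_false p c d v W n v₁ W₁ hp _ ih =>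
    intro Λ M emb q hM
    rw [Function.iterate_add_apply, one, hM]
    simp only [start, trans, TM2.stepAux, hp, cond_false]
    exact ih M (fun l => emb (some (.inr l))) q (fun l => hM (some (Sum.inr l)))
  | @loop_true p c v W n v₁ W₁ m v₂ W₂ hp _ _ ih₁ ih₂ =>
    intro Λ M emb q hM
    rw [Function.iterate_add_apply, one, hM, Nat.add_comm, Function.iterate_add_apply]
    simp only [start, trans, TM2.stepAux, hp, cond_true]
    rw [ih₁ M (fun l => emb (some l)) (.goto fun _ => emb none) (fun l => hM (some l))]
    exact ih₂ M emb q hM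
  | loop_false hp =>
    intro Λ M emb q hM
    rw [one, hM]
    simp only [start, trans, TM2.stepAux, hp, cond_false]

/-- Stacks given by their contents. -/
def mk (a b c d : List Sym) : Stacks
  | .io => a
  | .main => b
  | .stash => c
  | .ctr => d

section
variable (a b c d x : List Sym)
@[simp] theorem mk_io : mk a b c d .io = a := rfl
@[simp] theorem mk_main : mk a b c d .main = b := rfl
@[simp] theorem mk_stash : mk a b c d .stash = c := rfl
@[simp] theorem mk_ctr : mk a b c d .ctr = d := rfl
@[simp] theorem update_io : Function.update (mk a b c d) .io x = mk x b c d := by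
  funext k; cases k <;> simp [Function.update]
@[simp] theorem update_main : Function.update (mk a b c d) .main x = mk a x c d := by
  funext k; cases k <;> simp [Function.update]
@[simp] theorem update_stash : Function.update (mk a b c d) .stash x = mk a b x d := by
  funext k; cases k <;> simp [Function.update]
@[simp] theorem update_ctr : Function.update (mk a b c d) .ctr x = mk a b c x := by
  funext k; cases k <;> simp [Function.update]
end

/-- The machine that runs a program. -/
def machine (c : Cmd) : Turing.FinTM2 where
  K := Stk
  k₀ := .io
  k₁ := .io
  Γ _ := Sym
  Λ := Lab c
  main := start c
  σ := Reg
  initialState := none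
  m := trans c id .halt

theorem machine_initList (c : Cmd) (l : List Sym) :
    Turing.initList (machine c) l = ⟨some (start c), none, mk l [] [] []⟩ := by
  unfold Turing.initList
  congr 1
  funext k
  cases k <;> rfl

theorem machine_haltList (c : Cmd) (l : List Sym) :
    Turing.haltList (machine c) l = ⟨none, none, mk l [] [] []⟩ := by
  unfold Turing.haltList
  congr 1
  funext k
  cases k <;> rfl

/-- The prescribed halting configuration has the initial register value and no stack contents
besides the output; hence the final `none` and the empty stacks. -/
theorem isPolyTime_of_exec {f : List Bool × ℕ → List Bool × ℕ} (c : Cmd) (p : Polynomial ℕ)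
    (h : ∀ y, ∃ n ≤ p.eval (encodePair y).length,
      Exec c none (mk (encodePair y) [] [] []) n none (mk (encodePair (f y)) [] [] [])) :
    IsPolyTime f := by
  choose n hn hex using h
  refine ⟨{ tm := machine c, inputAlphabet := Equiv.refl _, outputAlphabet := Equiv.refl _,
            time := p, outputsFun := fun y => ⟨⟨n y, ?_⟩, hn y⟩ }⟩
  have e := (hex y).simulate (machine c).m id .halt (fun _ => rfl)
  simp only [Option.map_some]
  erw [List.map_id, List.map_id, machine_initList, machine_haltList]
  exact e

end StackProg

namespace StackProg

/-! ### Binary trees on the main stack -/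

/-- The universal data type: binary trees. -/
inductive Tr
  | nil
  | node (a b : Tr)

namespace Tr

/-- The number of nodes and leaves. -/
def size : Tr → ℕ
  | nil => 1
  | node a b => size a + size b + 1

/-- The preorder code of a tree. -/
def code : Tr → List Sym
  | nil => [some false]
  | node a b => some true :: (code a ++ code b)

theorem length_code (t : Tr) : t.code.length = t.size := by
  induction t with
  | nil => rfl
  | node a b iha ihb => simp [code, size, iha, ihb]

theorem none_notMem_code (t : Tr) : none ∉ t.code := by
  induction t with
  | nil => simp [code]
  | node a b iha ihb => simp [code, iha, ihb]

theorem size_pos (t : Tr) : 0 < t.size := by cases t <;> simp [size]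

end Tr

open Tr

section
variable {v : Reg} {io r T C : List Sym} {x : Sym} {f : Reg → Sym}

theorem exec_pop_main : Exec (.pop .main) v (mk io (x :: r) T C) 1 (some x) (mk io r T C) :=
  .pop (by simp) (by simp)

theorem exec_pop_stash : Exec (.pop .stash) v (mk io r (x :: T) C) 1 (some x) (mk io r T C) :=
  .pop (by simp) (by simp)

theorem exec_pop_ctr : Exec (.pop .ctr) v (mk io r T C) 1 C.head? (mk io r T C.tail) :=
  .pop (by simp) (by simp)

theorem exec_pop_io : Exec (.pop .io) v (mk io r T C) 1 io.head? (mk io.tail r T C) :=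
  .pop (by simp) (by simp)

theorem exec_push_main : Exec (.push .main f) v (mk io r T C) 1 v (mk io (f v :: r) T C) :=
  .push (by simp)

theorem exec_push_stash : Exec (.push .stash f) v (mk io r T C) 1 v (mk io r (f v :: T) C) :=
  .push (by simp)

theorem exec_push_ctr : Exec (.push .ctr f) v (mk io r T C) 1 v (mk io r T (f v :: C)) :=
  .push (by simp)

theorem exec_push_io : Exec (.push .io f) v (mk io r T C) 1 v (mk (f v :: io) r T C) :=
  .push (by simp)

end

def isOne (v : Reg) : Bool := v == some (some true)
def isSymbol (v : Reg) : Bool := v.isSome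
def notSep (v : Reg) : Bool := v != some none

def pushReg (k : Stk) : Cmd := .push k fun v => v.getD none
def pushSym (k : Stk) (a : Sym) : Cmd := .push k fun _ => a

/-- The body of the loop in `stashTop`. -/
def stashBody : Cmd :=
  .pop .main ;; pushReg .stash ;;
    .ite isOne (pushSym .ctr (some true) ;; pushSym .ctr (some true)) .skip ;; .pop .ctr

/-- Move the topmost tree of the main stack to the stash, on top of a separator. -/
def stashTop : Cmd :=
  pushSym .stash none ;; pushSym .ctr (some true) ;; .pop .ctr ;; .loop isSymbol stashBody

/-- Register and counter together hold, in unary, the number of trees still to be read: each symbol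
uses up one of them, and an inner node adds two for its subtrees. The statement extends a run that
starts after `t` backwards over `t`; therefore the right subtree is treated before the left one. -/
theorem exec_stashLoop (t : Tr) : ∀ {io r T C : List Sym} {m : ℕ} {x : Sym} {v' : Reg} {W' : Stacks},
    Exec (.loop isSymbol stashBody) C.head? (mk io r (t.code.reverse ++ T) C.tail) m v' W' →
    ∃ n ≤ m + 8 * t.size,
      Exec (.loop isSymbol stashBody) (some x) (mk io (t.code ++ r) T C) n v' W' := by
  induction t with
  | nil =>
    intro io r T C m x v' W' h
    refine ⟨_, ?_, .loop_true rfl (.seq exec_pop_main (.seq exec_push_stash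
      (.seq (.ite_false rfl .skip) exec_pop_ctr))) h⟩
    simp [size]; omega
  | node a b iha ihb =>
    intro io r T C m x v' W' h
    have h' : Exec (.loop isSymbol stashBody) C.head?
        (mk io r (b.code.reverse ++ (a.code.reverse ++ some true :: T)) C.tail) m v' W' := by
      simpa [code] using h
    obtain ⟨n₁, hn₁, h₁⟩ := ihb (x := some true) h'
    obtain ⟨n₂, hn₂, h₂⟩ := iha (C := some true :: C) (x := some true) h₁
    refine ⟨_, ?_, .loop_true rfl (.seq exec_pop_main (.seq exec_push_stash
      (.seq (.ite_true rfl (.seq exec_push_ctr exec_push_ctr)) exec_pop_ctr))) (?_ : Exec _ _ _ n₂ _ _)⟩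
    · simp [size]; omega
    · simpa [code] using h₂

theorem exec_stashTop (t : Tr) (v : Reg) (io r T : List Sym) :
    ∃ n ≤ 8 * t.size + 4, Exec stashTop v (mk io (t.code ++ r) T []) n none
      (mk io r (t.code.reverse ++ none :: T) []) := by
  obtain ⟨n, hn, h⟩ := exec_stashLoop t (io := io) (r := r) (T := none :: T) (C := [])
    (x := some true) (.loop_false rfl)
  exact ⟨_, by omega, .seq exec_push_stash (.seq exec_push_ctr (.seq exec_pop_ctr h))⟩

/-- Move the topmost word of the stash back to the main stack. -/
def unstash : Cmd :=
  .pop .stash ;; .loop notSep (pushReg .main ;; .pop .stash)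

theorem exec_unstash_word (u : List Sym) (hu : none ∉ u) : ∀ (v : Reg) (io r T C : List Sym),
    ∃ n ≤ 3 * u.length + 2, Exec unstash v (mk io r (u ++ none :: T) C) n (some none)
      (mk io (u.reverse ++ r) T C) := by
  induction u with
  | nil => exact fun v io r T C => ⟨_, by simp, .seq exec_pop_stash (.loop_false rfl)⟩
  | cons x u ih =>
    intro v io r T C
    obtain ⟨x, rfl⟩ : ∃ y, x = some y := Option.ne_none_iff_exists'.1 fun h => hu (by simp [h])
    obtain ⟨n, hn, h⟩ := ih (fun h => hu (by simp [h])) (some (some x)) io (some x :: r) T C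
    cases h with
    | seq h₁ h₂ =>
      refine ⟨_, ?_, .seq exec_pop_stash (.loop_true rfl (.seq exec_push_main h₁) (by simpa using h₂))⟩
      simp; omega

theorem exec_unstash (t : Tr) (v : Reg) (io r T : List Sym) :
    ∃ n ≤ 3 * t.size + 2, Exec unstash v (mk io r (t.code.reverse ++ none :: T) []) n (some none)
      (mk io (t.code ++ r) T []) := by
  simpa [length_code] using exec_unstash_word t.code.reverse
    (by simpa using t.none_notMem_code) v io r T []

/-- Remove the topmost word of the stash. -/
def dropStash : Cmd := .pop .stash ;; .loop notSep (.pop .stash)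

theorem exec_dropStash_word (u : List Sym) (hu : none ∉ u) : ∀ (v : Reg) (io r T C : List Sym),
    ∃ n ≤ 2 * u.length + 2, Exec dropStash v (mk io r (u ++ none :: T) C) n (some none)
      (mk io r T C) := by
  induction u with
  | nil => exact fun v io r T C => ⟨_, by simp, .seq exec_pop_stash (.loop_false rfl)⟩
  | cons x u ih =>
    intro v io r T C
    obtain ⟨x, rfl⟩ : ∃ y, x = some y := Option.ne_none_iff_exists'.1 fun h => hu (by simp [h])
    obtain ⟨n, hn, h⟩ := ih (fun h => hu (by simp [h])) (some (some x)) io r T C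
    cases h with
    | seq h₁ h₂ =>
      refine ⟨_, ?_, .seq exec_pop_stash (.loop_true rfl h₁ h₂)⟩
      simp; omega

/-- Remove the topmost tree of the main stack. -/
def dropTop : Cmd := stashTop ;; dropStash

theorem exec_dropTop (t : Tr) (v : Reg) (io r T : List Sym) :
    ∃ n ≤ 10 * t.size + 6, Exec dropTop v (mk io (t.code ++ r) T []) n (some none)
      (mk io r T []) := by
  obtain ⟨n, hn, h⟩ := exec_stashTop t v io r T
  obtain ⟨n', hn', h'⟩ := exec_dropStash_word t.code.reverse (by simpa using t.none_notMem_code)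
    none io r T []
  simp only [List.length_reverse, length_code] at hn'
  exact ⟨_, by omega, .seq h h'⟩

/-- Move the topmost word of the stash to the main stack and, in the same order, to the counter
stack. -/
def unstashTwice : Cmd :=
  .pop .stash ;; .loop notSep (pushReg .main ;; pushReg .ctr ;; .pop .stash)

theorem exec_unstashTwice_word (u : List Sym) (hu : none ∉ u) : ∀ (v : Reg) (io r T C : List Sym),
    ∃ n ≤ 4 * u.length + 2, Exec unstashTwice v (mk io r (u ++ none :: T) C) n (some none)
      (mk io (u.reverse ++ r) T (u.reverse ++ C)) := by
  induction u with
  | nil => exact fun v io r T C => ⟨_, by simp, .seq exec_pop_stash (.loop_false rfl)⟩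
  | cons x u ih =>
    intro v io r T C
    obtain ⟨x, rfl⟩ : ∃ y, x = some y := Option.ne_none_iff_exists'.1 fun h => hu (by simp [h])
    obtain ⟨n, hn, h⟩ := ih (fun h => hu (by simp [h])) (some (some x)) io (some x :: r) T
      (some x :: C)
    cases h with
    | seq h₁ h₂ =>
      refine ⟨_, ?_, .seq exec_pop_stash (.loop_true rfl
        (.seq exec_push_main (.seq exec_push_ctr h₁)) (by simpa using h₂))⟩
      simp; omega

/-- Empty the counter stack onto the stash. -/
def ctrToStash : Cmd := .pop .ctr ;; .loop isSymbol (pushReg .stash ;; .pop .ctr)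

theorem exec_ctrToStash (C : List Sym) : ∀ (v : Reg) (io r T : List Sym),
    ∃ n ≤ 3 * C.length + 2, Exec ctrToStash v (mk io r T C) n none
      (mk io r (C.reverse ++ T) []) := by
  induction C with
  | nil => exact fun v io r T => ⟨_, by simp, .seq exec_pop_ctr (.loop_false rfl)⟩
  | cons x C ih =>
    intro v io r T
    obtain ⟨n, hn, h⟩ := ih (some x) io r (x :: T)
    cases h with
    | seq h₁ h₂ =>
      refine ⟨_, ?_, .seq exec_pop_ctr (.loop_true rfl
        (.seq exec_push_stash h₁) (by simpa using h₂))⟩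
      simp; omega

/-- Duplicate the topmost tree of the main stack. -/
def dupTop : Cmd :=
  stashTop ;; unstashTwice ;; pushSym .stash none ;; ctrToStash ;; unstash

theorem exec_dupTop (t : Tr) (v : Reg) (io r T : List Sym) :
    ∃ n ≤ 18 * t.size + 11, Exec dupTop v (mk io (t.code ++ r) T []) n (some none)
      (mk io (t.code ++ (t.code ++ r)) T []) := by
  obtain ⟨n₁, hn₁, h₁⟩ := exec_stashTop t v io r T
  obtain ⟨n₂, hn₂, h₂⟩ := exec_unstashTwice_word t.code.reverse
    (by simpa using t.none_notMem_code) none io r T []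
  obtain ⟨n₃, hn₃, h₃⟩ := exec_ctrToStash t.code (some none) io (t.code ++ r) (none :: T)
  obtain ⟨n₄, hn₄, h₄⟩ := exec_unstash t none io (t.code ++ r) T
  simp only [List.length_reverse, length_code, List.reverse_reverse, List.append_nil] at hn₂ hn₃ h₂
  exact ⟨_, by omega, .seq h₁ (.seq h₂ (.seq exec_push_stash (.seq h₃ h₄)))⟩

/-- Replace the topmost tree of the main stack by its left subtree. -/
def leftTop : Cmd :=
  .pop .main ;; .ite isOne (stashTop ;; dropTop ;; unstash) (pushSym .main (some false))

/-- Replace the topmost tree of the main stack by its right subtree. -/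
def rightTop : Cmd :=
  .pop .main ;; .ite isOne dropTop (pushSym .main (some false))

/-- The left subtree; a leaf is its own left subtree. -/
def Tr.left : Tr → Tr
  | nil => nil
  | node a _ => a

/-- The right subtree; a leaf is its own right subtree. -/
def Tr.right : Tr → Tr
  | nil => nil
  | node _ b => b

theorem exec_leftTop (t : Tr) (v : Reg) (io r T : List Sym) :
    ∃ n ≤ 11 * t.size + 20, ∃ v', Exec leftTop v (mk io (t.code ++ r) T []) n v'
      (mk io (t.left.code ++ r) T []) := by
  cases t with
  | nil => exact ⟨_, by simp [size], _, .seq exec_pop_main (.ite_false rfl exec_push_main)⟩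
  | node a b =>
    obtain ⟨n₁, hn₁, h₁⟩ := exec_stashTop a (some (some true)) io (b.code ++ r) T
    obtain ⟨n₂, hn₂, h₂⟩ := exec_dropTop b none io r (a.code.reverse ++ none :: T)
    obtain ⟨n₃, hn₃, h₃⟩ := exec_unstash a (some none) io r T
    rw [← List.append_assoc] at h₁
    refine ⟨_, ?_, _, .seq exec_pop_main (.ite_true rfl (.seq h₁ (.seq h₂ h₃)))⟩
    simp [size]; omega

theorem exec_rightTop (t : Tr) (v : Reg) (io r T : List Sym) :
    ∃ n ≤ 11 * t.size + 20, ∃ v', Exec rightTop v (mk io (t.code ++ r) T []) n v'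
      (mk io (t.right.code ++ r) T []) := by
  cases t with
  | nil => exact ⟨_, by simp [size], _, .seq exec_pop_main (.ite_false rfl exec_push_main)⟩
  | node a b =>
    obtain ⟨n₁, hn₁, h₁⟩ := exec_dropTop a (some (some true)) io (b.code ++ r) T
    rw [← List.append_assoc] at h₁
    refine ⟨_, ?_, _, .seq exec_pop_main (.ite_true rfl h₁)⟩
    simp [size]; omega

/-- Push a word on the main stack, its last symbol first. -/
def pushWord : List Sym → Cmd
  | [] => .skip
  | a :: u => pushWord u ;; pushSym .main a

theorem exec_pushWord (u : List Sym) (v : Reg) (io r T C : List Sym) :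
    Exec (pushWord u) v (mk io r T C) (u.length + 1) v (mk io (u ++ r) T C) := by
  induction u with
  | nil => exact .skip
  | cons a u ih => exact .seq ih exec_push_main

/-! ### Functions that stack programs compute in polynomial time -/

/-- Coefficients are natural numbers, so polynomial bounds can be substituted into each other. -/
theorem eval_mono (p : Polynomial ℕ) {a b : ℕ} (h : a ≤ b) : p.eval a ≤ p.eval b := by
  induction p using Polynomial.induction_on' with
  | add p q hp hq => simpa using Nat.add_le_add hp hq
  | monomial n c => simpa using Nat.mul_le_mul_left _ (Nat.pow_le_pow_left h n)

/-- Types whose elements are represented by trees. -/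
class Enc (α : Type) where
  enc : α → Tr


/-- The size of the representation of `a`. -/
def esize {α : Type} [Enc α] (a : α) : ℕ := (Enc.enc a).size

end StackProg

namespace StackProg

open Tr

/-- `f` is computed by a stack program in polynomial time: the program replaces the code of the
argument on the main stack by the code of the value and leaves everything else alone. -/
@[fun_prop]
def Feasible {α β : Type} [Enc α] [Enc β] (f : α → β) : Prop :=
  ∃ (c : Cmd) (p : Polynomial ℕ), ∀ a, esize (f a) ≤ p.eval (esize a) ∧
    ∀ v io r T, ∃ n ≤ p.eval (esize a), ∃ v',
      Exec c v (mk io ((Enc.enc a).code ++ r) T []) n v' (mk io ((Enc.enc (f a)).code ++ r) T [])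

namespace Feasible

variable {α β γ δ ε : Type} [Enc α] [Enc β] [Enc γ] [Enc δ] [Enc ε]

theorem of_enc_eq {f : α → β} (h : ∀ a, Enc.enc (f a) = Enc.enc a) : Feasible f := by
  refine ⟨.skip, .X + 1, fun a => ⟨by simp [esize, h], fun v io r T => ⟨1, by simp, v, ?_⟩⟩⟩
  rw [h]
  exact .skip

@[fun_prop] theorem id : Feasible (fun a : α => a) := of_enc_eq fun _ => rfl

@[fun_prop] theorem comp {g : β → γ} {f : α → β} (hg : Feasible g) (hf : Feasible f) :
    Feasible (fun a => g (f a)) := by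
  obtain ⟨c, p, h⟩ := hf
  obtain ⟨d, q, k⟩ := hg
  refine ⟨c ;; d, p + q.comp p, fun a => ⟨?_, fun v io r T => ?_⟩⟩
  · have := (k (f a)).1.trans (eval_mono q (h a).1)
    simp only [Polynomial.eval_add, Polynomial.eval_comp]
    omega
  · obtain ⟨n, hn, v₁, e₁⟩ := (h a).2 v io r T
    obtain ⟨m, hm, v₂, e₂⟩ := (k (f a)).2 v₁ io r T
    refine ⟨n + m, ?_, v₂, .seq e₁ e₂⟩
    have := hm.trans (eval_mono q (h a).1)
    simp only [Polynomial.eval_add, Polynomial.eval_comp]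
    omega

theorem congr {f g : α → β} (hf : Feasible f) (h : ∀ a, f a = g a) : Feasible g := by
  obtain rfl : f = g := funext h
  exact hf

end Feasible

/-! ### Representation of the basic data types by trees, and its size -/

instance : Enc Tr := ⟨fun t => t⟩
instance : Enc Unit := ⟨fun _ => .nil⟩
instance : Enc Bool := ⟨fun b => cond b (.node .nil .nil) .nil⟩

def encOption {α : Type} (e : α → Tr) : Option α → Tr
  | none => .nil
  | some a => .node (e a) .nil

def encNat : ℕ → Tr
  | 0 => .nil
  | n + 1 => .node .nil (encNat n)

def encList {α : Type} (e : α → Tr) : List α → Tr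
  | [] => .nil
  | a :: l => .node (e a) (encList e l)

instance {α : Type} [Enc α] : Enc (Option α) := ⟨encOption Enc.enc⟩
instance : Enc ℕ := ⟨encNat⟩
instance {α : Type} [Enc α] : Enc (List α) := ⟨encList Enc.enc⟩
instance {α β : Type} [Enc α] [Enc β] : Enc (α × β) := ⟨fun p => .node (Enc.enc p.1) (Enc.enc p.2)⟩

section sizes
variable {α β : Type} [Enc α] [Enc β]

@[simp] theorem enc_tree (t : Tr) : Enc.enc t = t := rfl
theorem enc_nil : Enc.enc ([] : List α) = .nil := rfl
theorem enc_cons (a : α) (l : List α) : Enc.enc (a :: l) = .node (Enc.enc a) (Enc.enc l) := rfl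
theorem enc_succ (n : ℕ) : Enc.enc (n + 1) = .node .nil (Enc.enc n) := rfl

theorem esize_pair (a : α) (b : β) : esize (a, b) = esize a + esize b + 1 := rfl
theorem esize_nil : esize ([] : List α) = 1 := rfl
theorem esize_cons (a : α) (l : List α) : esize (a :: l) = esize a + esize l + 1 := rfl
theorem esize_pos (a : α) : 0 < esize a := size_pos _

theorem esize_nat (n : ℕ) : esize n = 2 * n + 1 := by
  induction n with
  | zero => rfl
  | succ n ih => simp only [esize, enc_succ, size] at ih ⊢; omega

theorem esize_bool_le (b : Bool) : esize b ≤ 3 := by cases b <;> decide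

theorem esize_append (l l' : List α) : esize (l ++ l') + 1 = esize l + esize l' := by
  induction l with
  | nil => simp only [List.nil_append, esize_nil]; omega
  | cons a l ih => simp only [List.cons_append, esize_cons]; omega

theorem esize_le_of_mem {a : α} {l : List α} (h : a ∈ l) : esize a ≤ esize l := by
  induction l with
  | nil => simp at h
  | cons b l ih =>
    rw [esize_cons]
    rcases List.mem_cons.1 h with rfl | h
    · omega
    · have := ih h; omega

theorem length_le_esize (l : List α) : l.length ≤ esize l := by
  induction l with
  | nil => simp
  | cons b l ih => rw [esize_cons, List.length_cons]; omega

theorem esize_list_le (l : List α) (A : ℕ) (h : ∀ a ∈ l, esize a ≤ A) :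
    esize l ≤ l.length * (A + 1) + 1 := by
  induction l with
  | nil => simp [esize_nil]
  | cons b l ih =>
    have h₁ := h b (by simp)
    have h₂ := ih fun a ha => h a (by simp [ha])
    rw [esize_cons, List.length_cons, Nat.succ_mul]
    omega

theorem esize_reverse (l : List α) : esize l.reverse = esize l := by
  induction l with
  | nil => rfl
  | cons b l ih =>
    have := esize_append l.reverse [b]
    rw [List.reverse_cons, esize_cons]
    rw [esize_cons, esize_nil] at this
    omega

end sizes

/-! ### Closure of the feasible functions under projections, pairing, branching and folds -/

namespace Feasible

variable {α β γ δ ε : Type} [Enc α] [Enc β] [Enc γ] [Enc δ] [Enc ε]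

theorem left : Feasible Tr.left := by
  refine ⟨leftTop, 11 * .X + 20, fun a => ⟨?_, fun v io r T => ?_⟩⟩
  · cases a <;> simp [esize, Enc.enc, Tr.left, size]; omega
  · simpa [esize] using exec_leftTop a v io r T

theorem right : Feasible Tr.right := by
  refine ⟨rightTop, 11 * .X + 20, fun a => ⟨?_, fun v io r T => ?_⟩⟩
  · cases a <;> simp [esize, Enc.enc, Tr.right, size]; omega
  · simpa [esize] using exec_rightTop a v io r T

/-- Transfer along the representation by trees. -/
theorem of_tree {f : α → β} (g : Tr → Tr) (hg : Feasible g)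
    (h : ∀ a, Enc.enc (f a) = g (Enc.enc a)) : Feasible f := by
  obtain ⟨c, p, k⟩ := hg
  refine ⟨c, p, fun a => ⟨?_, fun v io r T => ?_⟩⟩
  · simpa [esize, h] using (k (Enc.enc a)).1
  · rw [h]
    exact (k (Enc.enc a)).2 v io r T

@[fun_prop] theorem fst {f : γ → α × β} (hf : Feasible f) : Feasible (fun a => (f a).1) :=
  (of_tree (f := Prod.fst) _ left fun _ => rfl).comp hf

@[fun_prop] theorem snd {f : γ → α × β} (hf : Feasible f) : Feasible (fun a => (f a).2) :=
  (of_tree (f := Prod.snd) _ right fun _ => rfl).comp hf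

@[fun_prop] theorem const (b : β) : Feasible (fun _ : α => b) := by
  refine ⟨dropTop ;; pushWord (Enc.enc b).code, 10 * .X + .C (esize b + 7), fun a =>
    ⟨by simp; omega, fun v io r T => ?_⟩⟩
  obtain ⟨n, hn, h⟩ := exec_dropTop (Enc.enc a) v io r T
  have h' := exec_pushWord (Enc.enc b).code (some none) io r T []
  rw [length_code] at h'
  refine ⟨_, ?_, _, .seq h h'⟩
  simp [esize]; omega

@[fun_prop] theorem pair {f : α → β} {g : α → γ} (hf : Feasible f) (hg : Feasible g) :
    Feasible (fun a => (f a, g a)) := by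
  obtain ⟨c, p, h⟩ := hf
  obtain ⟨d, q, k⟩ := hg
  refine ⟨dupTop ;; c ;; stashTop ;; d ;; unstash ;; pushSym .main (some true),
    18 * .X + 12 * p + q + 18, fun a => ⟨?_, fun v io r T => ?_⟩⟩
  · have h₁ := (h a).1
    have h₂ := (k a).1
    simp only [esize_pair, Polynomial.eval_add, Polynomial.eval_mul, Polynomial.eval_ofNat,
      Polynomial.eval_X]
    omega
  · obtain ⟨n₁, hn₁, e₁⟩ := exec_dupTop (Enc.enc a) v io r T
    obtain ⟨n₂, hn₂, v₂, e₂⟩ := (h a).2 (some none) io ((Enc.enc a).code ++ r) T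
    obtain ⟨n₃, hn₃, e₃⟩ := exec_stashTop (Enc.enc (f a)) v₂ io ((Enc.enc a).code ++ r) T
    obtain ⟨n₄, hn₄, v₄, e₄⟩ := (k a).2 none io r ((Enc.enc (f a)).code.reverse ++ none :: T)
    obtain ⟨n₅, hn₅, e₅⟩ := exec_unstash (Enc.enc (f a)) v₄ io ((Enc.enc (g a)).code ++ r) T
    have h₁ := (h a).1
    simp only [esize] at *
    refine ⟨n₁ + (n₂ + (n₃ + (n₄ + (n₅ + 1)))), ?_, some none,
      .seq e₁ (.seq e₂ (.seq e₃ (.seq e₄ (.seq e₅ ?_))))⟩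
    · simp only [Polynomial.eval_add, Polynomial.eval_mul, Polynomial.eval_ofNat,
        Polynomial.eval_X]
      omega
    · refine .push ?_
      simp [Enc.enc, code]

@[fun_prop] theorem ite {b : α → Bool} {f g : α → β} (hb : Feasible b) (hf : Feasible f) (hg : Feasible g) :
    Feasible (fun a => if b a = true then f a else g a) := by
  obtain ⟨c, p, h⟩ := pair hb (id (α := α))
  obtain ⟨d₁, q₁, k₁⟩ := hf
  obtain ⟨d₂, q₂, k₂⟩ := hg
  -- The code of the pair `(b a, a)` starts with the mark of a node, and its second symbol is the
  -- value of `b a`. If that value is true, its two leaves must still be removed before `a` is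
  -- reached.
  refine ⟨c ;; .pop .main ;; .pop .main ;; .ite isOne (.pop .main ;; .pop .main ;; d₁) d₂,
    p + q₁ + q₂ + 5, fun a => ⟨?_, fun v io r T => ?_⟩⟩
  · have h₁ := (k₁ a).1
    have h₂ := (k₂ a).1
    simp only [Polynomial.eval_add, Polynomial.eval_ofNat]
    split <;> omega
  · obtain ⟨n, hn, v₁, e⟩ := (h a).2 v io r T
    simp only [Polynomial.eval_add, Polynomial.eval_ofNat]
    cases hb : b a
    · obtain ⟨m, hm, v₂, e₂⟩ := (k₂ a).2 (some (some false)) io r T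
      have e' : Exec c v (mk io ((Enc.enc a).code ++ r) T []) n v₁
          (mk io (some true :: some false :: ((Enc.enc a).code ++ r)) T []) := by
        simpa [Enc.enc, hb, code] using e
      refine ⟨_, ?_, v₂, .seq e' (.seq exec_pop_main (.seq exec_pop_main
        (.ite_false rfl (by simpa using e₂))))⟩
      omega
    · obtain ⟨m, hm, v₂, e₂⟩ := (k₁ a).2 (some (some false)) io r T
      have e' : Exec c v (mk io ((Enc.enc a).code ++ r) T []) n v₁
          (mk io (some true :: some true :: some false :: some false :: ((Enc.enc a).code ++ r))
            T []) := by
        simpa [Enc.enc, hb, code] using e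
      refine ⟨_, ?_, v₂, .seq e' (.seq exec_pop_main (.seq exec_pop_main
        (.ite_true rfl (.seq exec_pop_main (.seq exec_pop_main (by simpa using e₂))))))⟩
      omega

/-- The body of the loop in the program for `foldl`. -/
def foldBody (c : Cmd) : Cmd :=
  stashTop ;; unstash ;; unstash ;; pushSym .main (some true) ;; c ;; stashTop ;; .pop .main

/-- Loop invariant: the unread part of the list is on the main stack, with its first symbol already
in the register, and the accumulator waits on the stash. That symbol distinguishes `cons` from `[]`
and thus controls the loop. Bounding the accumulators of all prefixes by one number `B` makes the
cost of a pass uniform. -/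
theorem exec_fold {h : γ × α → γ} {c : Cmd} {p : Polynomial ℕ}
    (hc : ∀ x : γ × α, esize (h x) ≤ p.eval (esize x) ∧
      ∀ v io r T, ∃ n ≤ p.eval (esize x), ∃ v',
        Exec c v (mk io ((Enc.enc x).code ++ r) T []) n v' (mk io ((Enc.enc (h x)).code ++ r) T []))
    {A B : ℕ} (io r T : List Sym) : ∀ (l : List α) (s : γ), (∀ a ∈ l, esize a ≤ A) →
      (∀ l', l' <+: l → esize (l'.foldl (fun s a => h (s, a)) s) ≤ B) →
      ∃ n ≤ l.length * (11 * A + 11 * B + p.eval (B + A + 1) + 15) + 1,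
        Exec (.loop isOne (foldBody c)) (Enc.enc l).code.head?
          (mk io ((Enc.enc l).code.tail ++ r) ((Enc.enc s).code.reverse ++ none :: T) []) n
          (some (some false))
          (mk io r ((Enc.enc (l.foldl (fun s a => h (s, a)) s)).code.reverse ++ none :: T) []) := by
  intro l
  induction l with
  | nil => exact fun s _ _ => ⟨1, by simp, .loop_false rfl⟩
  | cons a l ih =>
    intro s hA hB
    obtain ⟨n, hn, e⟩ := ih (h (s, a)) (fun b hb => hA b (by simp [hb]))
      (fun l' hl' => hB (a :: l') (by simpa using hl'))
    have ha := hA a (by simp)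
    have hs : esize s ≤ B := hB [] (by simp)
    have hs' : esize (h (s, a)) ≤ B := hB [a] (by simp)
    obtain ⟨n₁, hn₁, e₁⟩ := exec_stashTop (Enc.enc a) (some (some true)) io
      ((Enc.enc l).code ++ r) ((Enc.enc s).code.reverse ++ none :: T)
    obtain ⟨n₂, hn₂, e₂⟩ := exec_unstash (Enc.enc a) none io ((Enc.enc l).code ++ r)
      ((Enc.enc s).code.reverse ++ none :: T)
    obtain ⟨n₃, hn₃, e₃⟩ := exec_unstash (Enc.enc s) (some none) io
      ((Enc.enc a).code ++ ((Enc.enc l).code ++ r)) T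
    obtain ⟨n₄, hn₄, v₄, e₄⟩ := (hc (s, a)).2 (some none) io ((Enc.enc l).code ++ r) T
    obtain ⟨n₅, hn₅, e₅⟩ := exec_stashTop (Enc.enc (h (s, a))) v₄ io ((Enc.enc l).code ++ r) T
    have hp : p.eval (esize (s, a)) ≤ p.eval (B + A + 1) :=
      eval_mono p (by rw [esize_pair]; omega)
    have e₆ : Exec (pushSym .main (some true)) (some none)
        (mk io ((Enc.enc s).code ++ ((Enc.enc a).code ++ ((Enc.enc l).code ++ r))) T []) 1
        (some none) (mk io ((Enc.enc (s, a)).code ++ ((Enc.enc l).code ++ r)) T []) := by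
      refine .push ?_
      simp [Enc.enc, code]
    have e₇ : Exec (.pop .main) none (mk io ((Enc.enc l).code ++ r)
        ((Enc.enc (h (s, a))).code.reverse ++ none :: T) []) 1 (Enc.enc l).code.head?
        (mk io ((Enc.enc l).code.tail ++ r)
          ((Enc.enc (h (s, a))).code.reverse ++ none :: T) []) := by
      have : ∃ x u, (Enc.enc l).code = x :: u := by
        cases hl : Enc.enc l with
        | nil => exact ⟨_, _, rfl⟩
        | node => exact ⟨_, _, rfl⟩
      obtain ⟨x, u, hx⟩ := this
      rw [hx]
      exact exec_pop_main
    simp only [esize] at *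
    refine ⟨(n₁ + (n₂ + (n₃ + (1 + (n₄ + (n₅ + 1)))))) + n + 1, ?_, .loop_true rfl ?_ e⟩
    · rw [List.length_cons, Nat.succ_mul]
      omega
    · refine .seq ?_ (.seq e₂ (.seq e₃ (.seq e₆ (.seq e₄ (.seq e₅ e₇)))))
      simpa [enc_cons, code] using e₁

/-- Iteration along a list, if the sizes of all intermediate results are bounded. -/
theorem foldl_aux {L : ε → List α} {i : ε → γ} {h : γ × α → γ} (hL : Feasible L) (hi : Feasible i)
    (hh : Feasible h) (q : Polynomial ℕ)
    (hq : ∀ e l, l <+: L e → esize (l.foldl (fun s a => h (s, a)) (i e)) ≤ q.eval (esize e)) :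
    Feasible (fun e => (L e).foldl (fun s a => h (s, a)) (i e)) := by
  obtain ⟨d, P, hd⟩ := pair hi hL
  obtain ⟨c, p, hc⟩ := hh
  refine ⟨d ;; .pop .main ;; stashTop ;; .pop .main ;; .loop isOne (foldBody c) ;; unstash,
    P + 11 * q + P * (11 * P + 11 * q + p.comp (q + P + 1) + 15) + 10, fun e =>
      ⟨?_, fun v io r T => ?_⟩⟩
  · have := hq e (L e) (List.prefix_refl _)
    simp only [Polynomial.eval_add, Polynomial.eval_mul, Polynomial.eval_ofNat]
    omega
  · have hPL := (hd e).1
    rw [esize_pair] at hPL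
    have hi : esize (i e) ≤ _ := hq e [] (by simp)
    have hf := hq e (L e) (List.prefix_refl _)
    obtain ⟨n₁, hn₁, v₁, e₁⟩ := (hd e).2 v io r T
    obtain ⟨n₂, hn₂, e₂⟩ := exec_stashTop (Enc.enc (i e)) (some (some true)) io
      ((Enc.enc (L e)).code ++ r) T
    obtain ⟨n₃, hn₃, e₃⟩ := exec_fold hc io r T (L e) (i e)
      (A := P.eval (esize e)) (B := q.eval (esize e))
      (fun a ha => (esize_le_of_mem ha).trans (by omega)) (hq e)
    obtain ⟨n₄, hn₄, e₄⟩ := exec_unstash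
      (Enc.enc ((L e).foldl (fun s a => h (s, a)) (i e))) (some (some false)) io r T
    have e₅ : Exec (.pop .main) none (mk io ((Enc.enc (L e)).code ++ r)
        ((Enc.enc (i e)).code.reverse ++ none :: T) []) 1 (Enc.enc (L e)).code.head?
        (mk io ((Enc.enc (L e)).code.tail ++ r)
          ((Enc.enc (i e)).code.reverse ++ none :: T) []) := by
      have : ∃ x u, (Enc.enc (L e)).code = x :: u := by
        cases hl : Enc.enc (L e) with
        | nil => exact ⟨_, _, rfl⟩
        | node => exact ⟨_, _, rfl⟩
      obtain ⟨x, u, hx⟩ := this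
      rw [hx]
      exact exec_pop_main
    have e₁' : Exec d v (mk io ((Enc.enc e).code ++ r) T []) n₁ v₁
        (mk io (some true :: ((Enc.enc (i e)).code ++ ((Enc.enc (L e)).code ++ r))) T []) := by
      simpa [Enc.enc, code] using e₁
    refine ⟨_, ?_, _, .seq e₁' (.seq exec_pop_main (.seq e₂ (.seq e₅ (.seq e₃ e₄))))⟩
    have hlen : (L e).length ≤ P.eval (esize e) := (length_le_esize _).trans (by omega)
    have := Nat.mul_le_mul_right (11 * P.eval (esize e) + 11 * q.eval (esize e) +
      p.eval (q.eval (esize e) + P.eval (esize e) + 1) + 15) hlen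
    simp only [Polynomial.eval_add, Polynomial.eval_mul, Polynomial.eval_ofNat,
      Polynomial.eval_comp, Polynomial.eval_one]
    simp only [esize] at *
    omega

end Feasible

end StackProg

namespace StackProg

open Tr

/-! ### Folds with parameters, and operations on lists and numbers -/

namespace Feasible

variable {α β γ δ ε : Type} [Enc α] [Enc β] [Enc γ] [Enc δ] [Enc ε]

/-- The argument `e`, on which the step may depend, travels along as a second component of the
accumulator. The bound `q` cannot be dropped: a feasible step may double the size of its argument,
and iteration would then give exponential size. -/
theorem foldl {L : ε → List α} {i : ε → γ} {h : ε → γ → α → γ} (hL : Feasible L)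
    (hi : Feasible i) (hh : Feasible (fun x : ε × γ × α => h x.1 x.2.1 x.2.2)) (q : Polynomial ℕ)
    (hq : ∀ e l, l <+: L e → esize (l.foldl (h e) (i e)) ≤ q.eval (esize e)) :
    Feasible (fun e => (L e).foldl (h e) (i e)) := by
  let H : (γ × ε) × α → γ × ε := fun x => (h x.1.2 x.1.1 x.2, x.1.2)
  have key : ∀ e (l : List α) s, l.foldl (fun s a => H (s, a)) (s, e) = (l.foldl (h e) s, e) := by
    intro e l
    induction l with
    | nil => exact fun s => rfl
    | cons a l ih => exact fun s => ih _
  have hH : Feasible H :=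
    pair (hh.comp (f := fun x : (γ × ε) × α => (x.1.2, x.1.1, x.2)) (by fun_prop)) (by fun_prop)
  have := foldl_aux hL (pair hi id) hH (q + .X + 1) fun e l hl => by
    rw [key, esize_pair]
    have := hq e l hl
    simp only [Polynomial.eval_add, Polynomial.eval_X, Polynomial.eval_one]
    omega
  exact (fst this).congr fun e => by rw [key]

@[fun_prop] theorem cons {f : ε → α} {l : ε → List α} (hf : Feasible f) (hl : Feasible l) :
    Feasible (fun e => f e :: l e) :=
  (of_enc_eq (f := fun p : α × List α => p.1 :: p.2) fun _ => rfl).comp (pair hf hl)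

@[fun_prop] theorem reverse {l : ε → List α} (hl : Feasible l) : Feasible (fun e => (l e).reverse) := by
  have := foldl (h := fun _ s a => a :: s) hl (const (α := ε) ([] : List α)) (by fun_prop)
  obtain ⟨c, p, hp⟩ := hl
  refine (this p fun e k hk => ?_).congr fun e => by simp
  refine le_trans ?_ (hp e).1
  obtain ⟨t, ht⟩ := hk
  rw [List.foldl_flip_cons_eq_append', List.append_nil, esize_reverse, ← ht]
  have := esize_append k t
  have := esize_pos t
  omega

end Feasible

theorem esize_le_of_prefix {α : Type} [Enc α] {k l : List α} (h : k <+: l) : esize k ≤ esize l := by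
  obtain ⟨t, rfl⟩ := h
  have := esize_append k t
  have := esize_pos t
  omega

theorem esize_flatten_le {α : Type} [Enc α] (l : List (List α)) : esize l.flatten ≤ esize l := by
  induction l with
  | nil => exact le_rfl
  | cons a l ih =>
    rw [List.flatten_cons, esize_cons]
    have := esize_append a l.flatten
    omega

theorem foldl_reverse_append {α : Type} (l : List (List α)) (s : List α) :
    l.foldl (fun s a => a.reverse ++ s) s = l.flatten.reverse ++ s := by
  induction l generalizing s with
  | nil => rfl
  | cons a l ih => simp [ih]

theorem Feasible.exists_bound {α β : Type} [Enc α] [Enc β] {f : α → β} (hf : Feasible f) :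
    ∃ p : Polynomial ℕ, ∀ a, esize (f a) ≤ p.eval (esize a) :=
  let ⟨_, p, h⟩ := hf
  ⟨p, fun a => (h a).1⟩

namespace Feasible

variable {α β γ δ ε : Type} [Enc α] [Enc β] [Enc γ] [Enc δ] [Enc ε]

@[fun_prop] theorem append {k l : ε → List α} (hk : Feasible k) (hl : Feasible l) :
    Feasible (fun e => k e ++ l e) := by
  obtain ⟨p, hp⟩ := hk.exists_bound
  obtain ⟨q, hq⟩ := hl.exists_bound
  refine (foldl (h := fun _ s a => a :: s) hk.reverse hl (by fun_prop) (p + q)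
    fun e j hj => ?_).congr fun e => by simp
  have h₁ := esize_le_of_prefix hj
  have h₂ := esize_append j.reverse (l e)
  have h₃ := hp e
  have h₄ := hq e
  rw [esize_reverse] at h₁ h₂
  rw [List.foldl_flip_cons_eq_append', Polynomial.eval_add]
  omega

@[fun_prop] theorem flatten {l : ε → List (List α)} (hl : Feasible l) :
    Feasible (fun e => (l e).flatten) := by
  obtain ⟨p, hp⟩ := hl.exists_bound
  have := foldl (h := fun _ s a => a.reverse ++ s) hl (const (α := ε) ([] : List α)) (by fun_prop)
    p fun e k hk => by
      rw [foldl_reverse_append, List.append_nil, esize_reverse]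
      exact (esize_flatten_le k).trans ((esize_le_of_prefix hk).trans (hp e))
  exact this.reverse.congr fun e => by
    rw [foldl_reverse_append, List.append_nil, List.reverse_reverse]

@[fun_prop] theorem map {l : ε → List α} {g : ε → α → β} (hl : Feasible l)
    (hg : Feasible (fun x : ε × α => g x.1 x.2)) : Feasible (fun e => (l e).map (g e)) := by
  obtain ⟨p, hp⟩ := hl.exists_bound
  obtain ⟨q, hq⟩ := hg.exists_bound
  have key : ∀ e (k : List α) s, k.foldl (fun s a => g e a :: s) s = (k.map (g e)).reverse ++ s := by
    intro e k
    induction k with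
    | nil => exact fun s => rfl
    | cons a k ih => exact fun s => by simp [ih]
  have := foldl (h := fun e s a => g e a :: s) hl (const (α := ε) ([] : List β))
    (cons (hg.comp (f := fun x : ε × List β × α => (x.1, x.2.2)) (by fun_prop)) (by fun_prop))
    (p * (q.comp (.X + p + 1) + 1) + 1) fun e k hk => by
      rw [key, List.append_nil, esize_reverse]
      have h₁ : ∀ b ∈ k.map (g e), esize b ≤ q.eval (esize e + p.eval (esize e) + 1) := by
        intro b hb
        obtain ⟨a, ha, rfl⟩ := List.mem_map.1 hb
        refine (hq (e, a)).trans (eval_mono q ?_)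
        have := esize_le_of_mem (hk.subset ha)
        have := hp e
        rw [esize_pair]
        omega
      have h₂ : k.length ≤ p.eval (esize e) :=
        (length_le_esize k).trans ((esize_le_of_prefix hk).trans (hp e))
      refine (esize_list_le _ _ h₁).trans ?_
      simp only [Polynomial.eval_add, Polynomial.eval_mul, Polynomial.eval_one,
        Polynomial.eval_comp, Polynomial.eval_X, List.length_map]
      exact Nat.succ_le_succ (Nat.mul_le_mul_right _ h₂)
  exact this.reverse.congr fun e => by simp [key]

@[fun_prop] theorem flatMap {l : ε → List α} {g : ε → α → List β} (hl : Feasible l)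
    (hg : Feasible (fun x : ε × α => g x.1 x.2)) : Feasible (fun e => (l e).flatMap (g e)) :=
  (flatten (map hl hg)).congr fun _ => rfl

@[fun_prop] theorem filter {l : ε → List α} {g : ε → α → Bool} (hl : Feasible l)
    (hg : Feasible (fun x : ε × α => g x.1 x.2)) : Feasible (fun e => (l e).filter (g e)) :=
  (flatMap (g := fun e a => if g e a = true then [a] else []) hl (by fun_prop)).congr fun e => by
    induction l e with
    | nil => rfl
    | cons a k ih => cases h : g e a <;> simp [h, ih]

/-! #### Natural numbers as lists of units -/

theorem enc_replicate (n : ℕ) : Enc.enc (List.replicate n ()) = Enc.enc n := by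
  induction n with
  | zero => rfl
  | succ n ih => rw [List.replicate_succ, enc_cons, enc_succ, ih]; rfl

@[fun_prop] theorem replicateUnit {f : ε → ℕ} (hf : Feasible f) :
    Feasible (fun e => List.replicate (f e) ()) :=
  (of_enc_eq (f := fun n => List.replicate n ()) enc_replicate).comp hf

@[fun_prop] theorem length {l : ε → List α} (hl : Feasible l) : Feasible (fun e => (l e).length) :=
  ((of_enc_eq (f := fun k : List Unit => k.length) fun k => by
    rw [← enc_replicate]; congr 1; exact (List.eq_replicate_of_mem fun _ _ => rfl).symm).comp
    (map (g := fun _ _ => ()) hl (const ()))).congr fun e => by simp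

@[fun_prop] theorem replicate {f : ε → ℕ} {a : ε → α} (hf : Feasible f) (ha : Feasible a) :
    Feasible (fun e => List.replicate (f e) (a e)) :=
  (map (g := fun e _ => a e) (replicateUnit hf) (by fun_prop)).congr fun e => by simp

@[fun_prop] theorem add {f g : ε → ℕ} (hf : Feasible f) (hg : Feasible g) :
    Feasible (fun e => f e + g e) :=
  (length (append (replicateUnit hf) (replicateUnit hg))).congr fun e => by simp

@[fun_prop] theorem mul {f g : ε → ℕ} (hf : Feasible f) (hg : Feasible g) :
    Feasible (fun e => f e * g e) :=
  (length (flatMap (g := fun e _ => List.replicate (g e) ()) (replicateUnit hf)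
    (by fun_prop))).congr fun e => by simp [List.length_flatMap]

-- The default values agree: `Tr.right` fixes the leaf just as `tail` fixes the empty list. The same
-- holds for the truncated predecessor of zero below.
@[fun_prop] theorem tail {l : ε → List α} (hl : Feasible l) : Feasible (fun e => (l e).tail) :=
  (of_tree (f := fun l : List α => l.tail) _ right fun l => by cases l <;> rfl).comp hl

@[fun_prop] theorem pred {f : ε → ℕ} (hf : Feasible f) : Feasible (fun e => f e - 1) :=
  (of_tree (f := fun n : ℕ => n - 1) _ right fun n => by cases n <;> rfl).comp hf

@[fun_prop] theorem headD_zero {l : ε → List ℕ} (hl : Feasible l) :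
    Feasible (fun e => (l e).headD 0) :=
  (of_tree (f := fun l : List ℕ => l.headD 0) _ left fun l => by cases l <;> rfl).comp hl

@[fun_prop] theorem sub {f g : ε → ℕ} (hf : Feasible f) (hg : Feasible g) :
    Feasible (fun e => f e - g e) := by
  obtain ⟨p, hp⟩ := hf.exists_bound
  have key : ∀ (k : List Unit) (n : ℕ), k.foldl (fun s _ => s - 1) n = n - k.length := by
    intro k
    induction k with
    | nil => exact fun n => rfl
    | cons a k ih => intro n; rw [List.foldl_cons, ih, List.length_cons]; omega
  refine (foldl (h := fun _ s _ => s - 1) (replicateUnit hg) hf (by fun_prop) p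
    fun e k _ => ?_).congr fun e => by simp [key]
  have := hp e
  rw [key]
  rw [esize_nat] at this ⊢
  omega

@[fun_prop] theorem min {f g : ε → ℕ} (hf : Feasible f) (hg : Feasible g) :
    Feasible (fun e => Min.min (f e) (g e)) :=
  (sub hf (sub hf hg)).congr fun e => by omega

/-- The program that tests whether the topmost tree is not a leaf. -/
def nodeTest : Cmd :=
  .pop .main ;; .ite isOne (dropTop ;; dropTop ;; pushWord (Enc.enc true).code)
    (pushSym .main (some false))

/-- The one test on data from which emptiness of lists and, via truncated subtraction, all
comparisons of numbers are derived. -/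
theorem of_nodeTest {f : α → Bool} (h₀ : ∀ a, Enc.enc a = .nil → f a = false)
    (h₁ : ∀ a s t, Enc.enc a = .node s t → f a = true) : Feasible f := by
  refine ⟨nodeTest, 10 * .X + 30, fun a => ⟨?_, fun v io r T => ?_⟩⟩
  · have := esize_bool_le (f a)
    simp; omega
  · cases h : Enc.enc a with
    | nil =>
      rw [h₀ a h]
      exact ⟨_, by simp, _, .seq exec_pop_main (.ite_false rfl exec_push_main)⟩
    | node s t =>
      obtain ⟨n, hn, e⟩ := exec_dropTop s (some (some true)) io (t.code ++ r) T
      obtain ⟨m, hm, e'⟩ := exec_dropTop t (some none) io r T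
      rw [← List.append_assoc] at e
      rw [h₁ a s t h]
      refine ⟨_, ?_, _, .seq exec_pop_main (.ite_true rfl (.seq e (.seq e' (exec_pushWord _ _ _ _ _ _))))⟩
      simp [esize, h, size, Enc.enc, code]
      omega

@[fun_prop] theorem isEmpty {l : ε → List α} (hl : Feasible l) :
    Feasible (fun e => (l e).isEmpty) := by
  have : Feasible (fun k : List α => !k.isEmpty) :=
    of_nodeTest (fun a h => by cases a <;> simp_all [enc_cons])
      (fun a s t h => by cases a <;> simp_all [enc_nil])
  exact (ite (this.comp hl) (const false) (const true)).congr fun e => by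
    cases (l e).isEmpty <;> rfl

@[fun_prop] theorem isSome {f : ε → Option α} (hf : Feasible f) :
    Feasible (fun e => (f e).isSome) :=
  (of_nodeTest (f := fun a : Option α => a.isSome)
    (fun a h => by cases a <;> simp_all [Enc.enc, encOption])
    (fun a s t h => by cases a <;> simp_all [Enc.enc, encOption])).comp hf

@[fun_prop] theorem getD_false {f : ε → Option Bool} (hf : Feasible f) :
    Feasible (fun e => (f e).getD false) :=
  (of_tree (f := fun a : Option Bool => a.getD false) _ left fun a => by cases a <;> rfl).comp hf

@[fun_prop] theorem some {f : ε → α} (hf : Feasible f) : Feasible (fun e => some (f e)) :=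
  (of_tree (α := α × Tr) (f := fun a : α × Tr => Option.some a.1) (fun t => .node t.left .nil)
    ((of_enc_eq (f := fun p : Tr × Tr => Tr.node p.1 p.2) fun _ => rfl).comp
      (pair left (const Tr.nil)))
    fun _ => rfl).comp (pair hf (const Tr.nil))

@[fun_prop] theorem not {f : ε → Bool} (hf : Feasible f) : Feasible (fun e => !(f e)) :=
  (ite hf (const false) (const true)).congr fun e => by cases f e <;> rfl

@[fun_prop] theorem and {f g : ε → Bool} (hf : Feasible f) (hg : Feasible g) :
    Feasible (fun e => f e && g e) :=
  (ite hf hg (const false)).congr fun e => by cases f e <;> rfl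

@[fun_prop] theorem or {f g : ε → Bool} (hf : Feasible f) (hg : Feasible g) :
    Feasible (fun e => f e || g e) :=
  (ite hf (const true) hg).congr fun e => by cases f e <;> rfl

@[fun_prop] theorem decide_lt {f g : ε → ℕ} (hf : Feasible f) (hg : Feasible g) :
    Feasible (fun e => decide (f e < g e)) :=
  (not (isEmpty (replicateUnit (sub hg hf)))).congr fun e => by
    by_cases h : f e < g e
    · simp [h]; omega
    · simp [h]; omega

@[fun_prop] theorem decide_le {f g : ε → ℕ} (hf : Feasible f) (hg : Feasible g) :
    Feasible (fun e => decide (f e ≤ g e)) :=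
  (not (decide_lt hg hf)).congr fun e => by
    by_cases h : f e ≤ g e
    · simp [h]
    · simp [h]; omega

@[fun_prop] theorem decide_eq {f g : ε → ℕ} (hf : Feasible f) (hg : Feasible g) :
    Feasible (fun e => decide (f e = g e)) :=
  (and (decide_le hf hg) (decide_le hg hf)).congr fun e => by
    by_cases h : f e = g e
    · simp [h]
    · simp [h]; omega

@[fun_prop] theorem all {l : ε → List α} {g : ε → α → Bool} (hl : Feasible l)
    (hg : Feasible (fun x : ε × α => g x.1 x.2)) : Feasible (fun e => (l e).all (g e)) :=
  (isEmpty (filter (g := fun e a => !(g e a)) hl (not hg))).congr fun e => by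
    induction l e with
    | nil => rfl
    | cons a k ih => cases h : g e a <;> simp [h, ih]

@[fun_prop] theorem any {l : ε → List α} {g : ε → α → Bool} (hl : Feasible l)
    (hg : Feasible (fun x : ε × α => g x.1 x.2)) : Feasible (fun e => (l e).any (g e)) :=
  (not (all (g := fun e a => !(g e a)) hl (not hg))).congr fun e => by
    simp [List.any_eq_not_all_not]

@[fun_prop] theorem countP {l : ε → List α} {g : ε → α → Bool} (hl : Feasible l)
    (hg : Feasible (fun x : ε × α => g x.1 x.2)) : Feasible (fun e => (l e).countP (g e)) :=
  (length (filter hl hg)).congr fun e => by rw [List.countP_eq_length_filter]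

@[fun_prop] theorem range {f : ε → ℕ} (hf : Feasible f) : Feasible (fun e => List.range (f e)) := by
  obtain ⟨p, hp⟩ := hf.exists_bound
  -- The next element is the length of the list built so far, so no separate counter has to be
  -- carried.
  have key : ∀ n : ℕ, (List.replicate n ()).foldl (fun s _ => s.length :: s) [] =
      (List.range n).reverse := by
    intro n
    induction n with
    | zero => rfl
    | succ n ih => rw [List.replicate_succ', List.foldl_append, ih]; simp [List.range_succ]
  have := foldl (h := fun _ s _ => s.length :: s) (replicateUnit hf) (const (α := ε) ([] : List ℕ))
    (by fun_prop) (p * (p + 1) + 1) fun e k hk => by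
      obtain ⟨hk₁, hk₂⟩ := List.prefix_replicate_iff.1 hk
      rw [hk₂, key, esize_reverse]
      have hpe := hp e
      rw [esize_nat] at hpe
      have h₁ : ∀ i ∈ List.range k.length, esize i ≤ p.eval (esize e) := by
        intro i hi
        rw [esize_nat]
        have := List.mem_range.1 hi
        omega
      refine (esize_list_le _ _ h₁).trans ?_
      simp only [Polynomial.eval_add, Polynomial.eval_mul, Polynomial.eval_one, List.length_range]
      exact Nat.succ_le_succ (Nat.mul_le_mul_right _ (by omega))
  exact this.reverse.congr fun e => by simp [key]

theorem eval (p : Polynomial ℕ) {f : ε → ℕ} (hf : Feasible f) : Feasible (fun e => p.eval (f e)) := by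
  induction p using Polynomial.induction_on' with
  | add p q hp hq => simpa using add hp hq
  | monomial n c =>
    simp only [Polynomial.eval_monomial]
    refine mul (const c) ?_
    induction n with
    | zero => simpa using const (α := ε) 1
    | succ n ih => simpa [pow_succ] using mul ih hf

end Feasible

end StackProg

namespace StackProg

open Tr

/-! ### Input and output -/

/-- Move the content of the input/output stack to the stash. -/
def ioToStash : Cmd := .pop .io ;; .loop isSymbol (pushReg .stash ;; .pop .io)

theorem exec_ioToStash (l : List Sym) : ∀ (v : Reg) (r T C : List Sym),
    ∃ n ≤ 3 * l.length + 2, Exec ioToStash v (mk l r T C) n none (mk [] r (l.reverse ++ T) C) := by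
  induction l with
  | nil => exact fun v r T C => ⟨_, by simp, .seq exec_pop_io (.loop_false rfl)⟩
  | cons x l ih =>
    intro v r T C
    obtain ⟨n, hn, h⟩ := ih (some x) r (x :: T) C
    cases h with
    | seq h₁ h₂ =>
      refine ⟨_, ?_, .seq exec_pop_io (.loop_true rfl (.seq exec_push_stash h₁)
        (by simpa using h₂))⟩
      simp; omega

theorem exec_pop_stash' {v : Reg} {io r T C : List Sym} :
    Exec (.pop .stash) v (mk io r T C) 1 T.head? (mk io r T.tail C) :=
  .pop (by simp) (by simp)

/-- Move the content of the stash to the input/output stack. -/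
def stashToIo : Cmd := .pop .stash ;; .loop isSymbol (pushReg .io ;; .pop .stash)

theorem exec_stashToIo (T : List Sym) : ∀ (v : Reg) (io r C : List Sym),
    ∃ n ≤ 3 * T.length + 2, Exec stashToIo v (mk io r T C) n none (mk (T.reverse ++ io) r [] C) := by
  induction T with
  | nil => exact fun v io r C => ⟨_, by simp, .seq exec_pop_stash' (.loop_false rfl)⟩
  | cons x T ih =>
    intro v io r C
    obtain ⟨n, hn, h⟩ := ih (some x) (x :: io) r C
    cases h with
    | seq h₁ h₂ =>
      refine ⟨_, ?_, .seq exec_pop_stash (.loop_true rfl (.seq exec_push_io h₁)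
        (by simpa using h₂))⟩
      simp; omega

/-- Put the symbol in the register in front of the list on top of the main stack. -/
def consSym : Cmd :=
  .ite (· == some none) (pushWord (some true :: (Enc.enc (none : Sym)).code))
    (.ite isOne (pushWord (some true :: (Enc.enc (some true : Sym)).code))
      (pushWord (some true :: (Enc.enc (some false : Sym)).code)))

theorem exec_consSym (x : Sym) (io r T C : List Sym) :
    ∃ n ≤ 9, Exec consSym (some x) (mk io r T C) n (some x)
      (mk io (some true :: (Enc.enc x).code ++ r) T C) := by
  obtain _ | _ | _ := x
  · exact ⟨_, by decide, .ite_true rfl (exec_pushWord _ _ _ _ _ _)⟩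
  · exact ⟨_, by decide, .ite_false rfl (.ite_false rfl (exec_pushWord _ _ _ _ _ _))⟩
  · exact ⟨_, by decide, .ite_false rfl (.ite_true rfl (exec_pushWord _ _ _ _ _ _))⟩

/-- Turn the content of the stash into the tree of the reversed list. -/
def buildList : Cmd :=
  pushSym .main (some false) ;; .pop .stash ;; .loop isSymbol (consSym ;; .pop .stash)

theorem exec_buildLoop (T : List Sym) : ∀ l : List Sym,
    ∃ n ≤ 11 * T.length + 1, Exec (.loop isSymbol (consSym ;; .pop .stash)) T.head?
      (mk [] (Enc.enc l).code T.tail []) n none (mk [] (Enc.enc (T.reverse ++ l)).code [] []) := by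
  induction T with
  | nil => exact fun l => ⟨_, by simp, .loop_false rfl⟩
  | cons x T ih =>
    intro l
    obtain ⟨n, hn, h⟩ := ih (x :: l)
    obtain ⟨m, hm, h'⟩ := exec_consSym x [] (Enc.enc l).code T []
    refine ⟨_, ?_, .loop_true rfl (.seq h' exec_pop_stash')
      (by rw [List.reverse_cons, List.append_assoc]; exact h)⟩
    simp; omega

/-- Read the input. -/
def readInput : Cmd := ioToStash ;; buildList

theorem exec_readInput (l : List Sym) :
    ∃ n ≤ 14 * l.length + 5, Exec readInput none (mk l [] [] []) n none
      (mk [] (Enc.enc l).code [] []) := by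
  obtain ⟨n, hn, h⟩ := exec_ioToStash l none [] [] []
  obtain ⟨m, hm, h'⟩ := exec_buildLoop l.reverse []
  simp only [List.reverse_reverse, List.append_nil, List.length_reverse] at hm h h'
  exact ⟨_, by omega, .seq h (.seq exec_push_main (.seq exec_pop_stash' h'))⟩

/-- Remove a symbol from the main stack and put it on the stash. -/
def unconsSym : Cmd :=
  .pop .main ;; .ite isOne (.pop .main ;; .ite isOne
    (.pop .main ;; .pop .main ;; .pop .main ;; pushSym .stash (some true))
    (.pop .main ;; pushSym .stash (some false))) (pushSym .stash none)

theorem exec_unconsSym (x : Sym) (v : Reg) (io r T C : List Sym) :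
    ∃ n ≤ 8, ∃ v', Exec unconsSym v (mk io ((Enc.enc x).code ++ r) T C) n v'
      (mk io r (x :: T) C) := by
  obtain _ | _ | _ := x
  · exact ⟨_, by decide, _, .seq exec_pop_main (.ite_false rfl exec_push_stash)⟩
  · exact ⟨_, by decide, _, .seq exec_pop_main (.ite_true rfl (.seq exec_pop_main
      (.ite_false rfl (.seq exec_pop_main exec_push_stash))))⟩
  · exact ⟨_, by decide, _, .seq exec_pop_main (.ite_true rfl (.seq exec_pop_main
      (.ite_true rfl (.seq exec_pop_main (.seq exec_pop_main (.seq exec_pop_main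
        exec_push_stash))))))⟩

theorem exec_pop_main' {v : Reg} {io r T C : List Sym} :
    Exec (.pop .main) v (mk io r T C) 1 r.head? (mk io r.tail T C) :=
  .pop (by simp) (by simp)

theorem exec_unbuildLoop (l : List Sym) : ∀ T : List Sym,
    ∃ n ≤ 10 * l.length + 1, Exec (.loop isOne (unconsSym ;; .pop .main)) (Enc.enc l).code.head?
      (mk [] (Enc.enc l).code.tail T []) n (some (some false)) (mk [] [] (l.reverse ++ T) []) := by
  induction l with
  | nil => exact fun T => ⟨_, by simp, .loop_false rfl⟩
  | cons x l ih =>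
    intro T
    obtain ⟨n, hn, h⟩ := ih (x :: T)
    obtain ⟨m, hm, v', h'⟩ := exec_unconsSym x (some (some true)) [] (Enc.enc l).code T []
    refine ⟨_, ?_, .loop_true rfl (.seq h' exec_pop_main') (by simpa using h)⟩
    simp; omega

/-- Write the output. -/
def writeOutput : Cmd := .pop .main ;; .loop isOne (unconsSym ;; .pop .main) ;; stashToIo

theorem exec_writeOutput (l : List Sym) (v : Reg) :
    ∃ n ≤ 13 * l.length + 4, Exec writeOutput v (mk [] (Enc.enc l).code [] []) n none
      (mk l [] [] []) := by
  obtain ⟨n, hn, h⟩ := exec_unbuildLoop l []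
  obtain ⟨m, hm, h'⟩ := exec_stashToIo l.reverse (some (some false)) [] [] []
  simp only [List.reverse_reverse, List.append_nil, List.length_reverse] at hm h h'
  exact ⟨_, by omega, .seq exec_pop_main' (.seq h h')⟩

theorem esize_sym_le (x : Sym) : esize x ≤ 5 := by
  obtain _ | _ | _ := x <;> decide

/-- A feasible function on words is computed by a Turing machine in polynomial time. -/
theorem Feasible.isPolyTime {F : List Sym → List Sym} (hF : Feasible F)
    {f : List Bool × ℕ → List Bool × ℕ} (h : ∀ y, F (encodePair y) = encodePair (f y)) :
    IsPolyTime f := by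
  obtain ⟨c, p, hc⟩ := hF
  refine isPolyTime_of_exec (readInput ;; c ;; writeOutput)
    (14 * .X + 14 * p.comp (6 * .X + 1) + 9) fun y => ?_
  obtain ⟨n₁, hn₁, h₁⟩ := exec_readInput (encodePair y)
  obtain ⟨n₂, hn₂, v, h₂⟩ := (hc (encodePair y)).2 none [] [] []
  obtain ⟨n₃, hn₃, h₃⟩ := exec_writeOutput (F (encodePair y)) v
  simp only [List.append_nil] at h₂
  rw [← h y]
  refine ⟨_, ?_, .seq h₁ (.seq h₂ h₃)⟩
  -- Each symbol costs at most five for itself and one for its list node.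
  have hs : esize (encodePair y) ≤ 6 * (encodePair y).length + 1 :=
    (esize_list_le _ 5 fun x _ => esize_sym_le x).trans (by omega)
  have h₄ := (length_le_esize _).trans ((hc (encodePair y)).1.trans (eval_mono p hs))
  have h₅ := hn₂.trans (eval_mono p hs)
  simp only [Polynomial.eval_add, Polynomial.eval_mul, Polynomial.eval_ofNat,
    Polynomial.eval_comp, Polynomial.eval_X, Polynomial.eval_one]
  omega

end StackProg

namespace ListElection

/-! ### The kernelization on the level of lists of numbers -/

/-- The list `l` has `x` before `y`. -/
def before (l : List ℕ) (x y : ℕ) : Bool :=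
  decide ((l.filter fun a => decide (a = x) || decide (a = y)).headD 0 = x)

/-- The number of lists with `x` before `y`. -/
def supp (P : List (List ℕ)) (x y : ℕ) : ℕ := P.countP fun l => before l x y

/-- The minimum of `supp P c z` over all `z ≠ c`, cut off at the number of lists. -/
def minSupp (m c : ℕ) (P : List (List ℕ)) : ℕ :=
  (List.range P.length).countP fun t =>
    (List.range m).all fun z => decide (z = c) || decide (t < supp P c z)

/-- The candidates other than `x` and `y`. -/
def others (m x y : ℕ) : List ℕ :=
  (List.range m).filter fun a => !(decide (a = x) || decide (a = y))

/-- Two votes that together prefer `x` to `y` and are indifferent otherwise. -/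
def votePair (m x y : ℕ) : List (List ℕ) :=
  [x :: y :: others m x y, (others m x y).reverse ++ [x, y]]

/-- The amount by which, in the reduced election, the support for `x` against `y` exceeds the least
support for the distinguished candidate, plus one. Here `ν` is that least support, `w` bounds the
excess, `M` is the number of manipulators, `a` is the support for `x` against `y` and `b` the support
for `y` against `x`. -/
def excess (ν w M a b : ℕ) : ℕ :=
  if decide (a < ν + M) = true then a + 1 - ν else w + 2 - min (b + 1 - ν) (M + 1)

/-- Half of `w`, rounded up. -/
def half (w : ℕ) : ℕ := (List.range w).countP fun t => decide (t + t < w)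

/-- How often the two votes of `votePair m x y` are cast in the reduced election. -/
def copies (ν w M : ℕ) (P : List (List ℕ)) (x y : ℕ) : ℕ :=
  if decide (x < y) = true then excess ν w M (supp P x y) (supp P y x) - (half w + 1)
  else if decide (y < x) = true then half w + 1 - excess ν w M (supp P y x) (supp P x y)
  else 0

/-- The votes of the reduced election. -/
def reducedVotes (m ν w M : ℕ) (P : List (List ℕ)) : List (List ℕ) :=
  (if decide (half w + half w = w) = true then [] else [List.range m]) ++
    (List.range m).flatMap fun x => (List.range m).flatMap fun y =>
      (List.replicate (copies ν w M P x y) ()).flatMap fun _ => votePair m x y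

/-- The non-manipulators' votes in the kernel. -/
def kernelVotes (m c M : ℕ) (P : List (List ℕ)) : List (List ℕ) :=
  if decide (P.length - (minSupp m c P + minSupp m c P) < M) = true then []
  else reducedVotes m (minSupp m c P) (min (P.length - (minSupp m c P + minSupp m c P)) (M + M)) M P

/-- One step of the decomposition of a bit string into unary codes. -/
def tokenStep (s : ℕ × List ℕ) (b : Bool) : ℕ × List ℕ :=
  if b = true then (s.1 + 1, s.2) else (0, s.1 :: s.2)

/-- The decomposition of a bit string into unary codes: the number of trailing ones, and the list
of the numbers, the last one first. -/
def tokens (x : List Bool) : ℕ × List ℕ := x.foldl tokenStep (0, [])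

/-- One step of the decomposition of a list into blocks of length `m`. -/
def blockStep (m : ℕ) (s : List ℕ × List (List ℕ)) (t : ℕ) : List ℕ × List (List ℕ) :=
  if decide (s.1.length + 1 = m) = true then ([], (s.1 ++ [t]) :: s.2) else (s.1 ++ [t], s.2)

/-- The decomposition of a list into blocks of length `m`: the last, incomplete block, and the list
of the other blocks, the last one first. -/
def blocks (m : ℕ) (l : List ℕ) : List ℕ × List (List ℕ) := l.foldl (blockStep m) ([], [])

/-- The data coded by a bit string: number of candidates, distinguished candidate, number of
manipulators, and votes. -/
def parse (x : List Bool) : ℕ × ℕ × ℕ × List (List ℕ) :=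
  let ts := (tokens x).2.reverse
  (ts.headD 0, ts.tail.headD 0, ts.tail.tail.headD 0, (blocks (ts.headD 0) ts.tail.tail.tail).2.reverse)

/-- The test whether the bit string `x` codes an instance with `k` candidates and at most `p k`
manipulators. -/
def valid (p : Polynomial ℕ) (y : List Bool × ℕ) : Bool :=
  decide ((tokens y.1).1 = 0) && decide (3 ≤ (tokens y.1).2.length) && decide ((parse y.1).1 = y.2) &&
  decide ((parse y.1).2.1 < (parse y.1).1) && decide (0 < (parse y.1).2.2.1) &&
  decide ((parse y.1).2.2.1 ≤ p.eval y.2) &&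
  (blocks (parse y.1).1 (tokens y.1).2.reverse.tail.tail.tail).1.isEmpty &&
  (parse y.1).2.2.2.all fun v => (List.range (parse y.1).1).all fun i => v.any fun a => decide (a = i)

/-- The bit string for a list of numbers. -/
def unary (l : List ℕ) : List Bool := l.flatMap fun n => List.replicate n true ++ [false]

/-- The kernelization algorithm. -/
def kernelize (p : Polynomial ℕ) (y : List Bool × ℕ) : List Bool × ℕ :=
  if valid p y = true then
    (unary ((parse y.1).1 :: (parse y.1).2.1 :: (parse y.1).2.2.1 ::
      (kernelVotes (parse y.1).1 (parse y.1).2.1 (parse y.1).2.2.1 (parse y.1).2.2.2).flatten), y.2)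
  else ([], 0)

end ListElection

/-! ### The algorithm runs in polynomial time -/

namespace StackProg.Feasible

open ListElection

variable {α β γ δ ε : Type} [Enc α] [Enc β] [Enc γ] [Enc δ] [Enc ε]

/-- Iteration along a list, if each step adds at most a multiple of the size of its argument. -/
theorem foldl_of_growth {L : ε → List α} {i : ε → γ} {h : ε → γ → α → γ} (hL : Feasible L)
    (hi : Feasible i) (hh : Feasible (fun x : ε × γ × α => h x.1 x.2.1 x.2.2)) (k : ℕ)
    (hk : ∀ e s a, esize (h e s a) ≤ esize s + k * (esize a + 1)) :
    Feasible (fun e => (L e).foldl (h e) (i e)) := by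
  obtain ⟨p, hp⟩ := hL.exists_bound
  obtain ⟨q, hq⟩ := hi.exists_bound
  refine foldl hL hi hh (q + .C k * p) fun e l hl => ?_
  have key : ∀ (l : List α) s, esize (l.foldl (h e) s) ≤ esize s + k * esize l := by
    intro l
    induction l with
    | nil => exact fun s => Nat.le_add_right _ _
    | cons a l ih =>
      intro s
      have h₁ := ih (h e s a)
      have h₂ := hk e s a
      rw [List.foldl_cons, esize_cons]
      have : k * (esize a + esize l + 1) = k * (esize a + 1) + k * esize l := by ring
      omega
  have h₁ := key l (i e)
  have h₂ := Nat.mul_le_mul_left k ((esize_le_of_prefix hl).trans (hp e))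
  have h₃ := hq e
  simp only [Polynomial.eval_add, Polynomial.eval_mul, Polynomial.eval_C]
  omega

@[fun_prop] theorem before {l : ε → List ℕ} {x y : ε → ℕ} (hl : Feasible l) (hx : Feasible x)
    (hy : Feasible y) : Feasible (fun e => before (l e) (x e) (y e)) := by
  unfold ListElection.before; fun_prop

@[fun_prop] theorem supp {P : ε → List (List ℕ)} {x y : ε → ℕ} (hP : Feasible P)
    (hx : Feasible x) (hy : Feasible y) : Feasible (fun e => supp (P e) (x e) (y e)) := by
  unfold ListElection.supp; fun_prop

@[fun_prop] theorem minSupp {m c : ε → ℕ} {P : ε → List (List ℕ)} (hm : Feasible m)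
    (hc : Feasible c) (hP : Feasible P) : Feasible (fun e => minSupp (m e) (c e) (P e)) := by
  unfold ListElection.minSupp; fun_prop

@[fun_prop] theorem others {m x y : ε → ℕ} (hm : Feasible m) (hx : Feasible x)
    (hy : Feasible y) : Feasible (fun e => others (m e) (x e) (y e)) := by
  unfold ListElection.others; fun_prop

@[fun_prop] theorem votePair {m x y : ε → ℕ} (hm : Feasible m) (hx : Feasible x)
    (hy : Feasible y) : Feasible (fun e => votePair (m e) (x e) (y e)) := by
  unfold ListElection.votePair; fun_prop

@[fun_prop] theorem excess {ν w M a b : ε → ℕ} (hν : Feasible ν) (hw : Feasible w)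
    (hM : Feasible M) (ha : Feasible a) (hb : Feasible b) :
    Feasible (fun e => excess (ν e) (w e) (M e) (a e) (b e)) := by
  unfold ListElection.excess; fun_prop

@[fun_prop] theorem half {w : ε → ℕ} (hw : Feasible w) : Feasible (fun e => half (w e)) := by
  unfold ListElection.half; fun_prop

@[fun_prop] theorem copies {ν w M x y : ε → ℕ} {P : ε → List (List ℕ)} (hν : Feasible ν)
    (hw : Feasible w) (hM : Feasible M) (hP : Feasible P) (hx : Feasible x) (hy : Feasible y) :
    Feasible (fun e => copies (ν e) (w e) (M e) (P e) (x e) (y e)) := by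
  unfold ListElection.copies; fun_prop

@[fun_prop] theorem reducedVotes {m ν w M : ε → ℕ} {P : ε → List (List ℕ)} (hm : Feasible m)
    (hν : Feasible ν) (hw : Feasible w) (hM : Feasible M) (hP : Feasible P) :
    Feasible (fun e => reducedVotes (m e) (ν e) (w e) (M e) (P e)) := by
  unfold ListElection.reducedVotes; fun_prop

@[fun_prop] theorem kernelVotes {m c M : ε → ℕ} {P : ε → List (List ℕ)} (hm : Feasible m)
    (hc : Feasible c) (hM : Feasible M) (hP : Feasible P) :
    Feasible (fun e => kernelVotes (m e) (c e) (M e) (P e)) := by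
  unfold ListElection.kernelVotes; fun_prop

@[fun_prop] theorem tokens {x : ε → List Bool} (hx : Feasible x) :
    Feasible (fun e => tokens (x e)) := by
  unfold ListElection.tokens
  refine foldl_of_growth (h := fun _ => tokenStep) hx (const _) ?_ 1 fun e s b => ?_
  · unfold tokenStep; fun_prop
  · obtain ⟨n, l⟩ := s
    cases b
    · simp only [tokenStep, Bool.false_eq_true, if_false, esize_pair, esize_cons, esize_nat]
      have := esize_pos false
      omega
    · simp only [tokenStep, if_true, esize_pair, esize_nat]
      have := esize_pos true
      omega

@[fun_prop] theorem blocks {m : ε → ℕ} {l : ε → List ℕ} (hm : Feasible m) (hl : Feasible l) :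
    Feasible (fun e => blocks (m e) (l e)) := by
  unfold ListElection.blocks
  refine foldl_of_growth (h := fun e => blockStep (m e)) hl (const _) ?_ 3 fun e s t => ?_
  · unfold blockStep; fun_prop
  · obtain ⟨u, k⟩ := s
    have := esize_append u [t]
    simp only [esize_cons, esize_nil] at this
    simp only [blockStep]
    split <;> simp only [esize_pair, esize_cons, esize_nil] <;> omega

@[fun_prop] theorem parse {x : ε → List Bool} (hx : Feasible x) :
    Feasible (fun e => parse (x e)) := by
  unfold ListElection.parse; fun_prop

@[fun_prop] theorem valid (p : Polynomial ℕ) {y : ε → List Bool × ℕ} (hy : Feasible y) :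
    Feasible (fun e => valid p (y e)) := by
  unfold ListElection.valid
  have := eval p hy.snd
  fun_prop

@[fun_prop] theorem unary {l : ε → List ℕ} (hl : Feasible l) : Feasible (fun e => unary (l e)) := by
  unfold ListElection.unary; fun_prop

theorem kernelize (p : Polynomial ℕ) : Feasible (kernelize p) := by
  unfold ListElection.kernelize; fun_prop

end StackProg.Feasible

namespace ListElection

open StackProg

/-- The kernelization algorithm on words. -/
theorem isPolyTime_kernelize (p : Polynomial ℕ) : IsPolyTime (kernelize p) := by
  let dec : List Sym → List Bool × ℕ := fun z =>
    ((z.filter fun a => a.isSome).map fun a => a.getD false, z.countP fun a => !a.isSome)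
  have hdec : Feasible dec := by fun_prop
  have henc : Feasible (fun y : List Bool × ℕ => encodePair y) := by
    unfold encodePair
    fun_prop
  refine (henc.comp ((Feasible.kernelize p).comp hdec)).isPolyTime fun y => ?_
  have : dec (encodePair y) = y := by
    obtain ⟨x, k⟩ := y
    refine Prod.ext ?_ ?_
    · simp [dec, encodePair, List.filter_map, Function.comp_def]
    · simp [dec, encodePair, List.countP_map, List.countP_replicate, Function.comp_def]
  rw [this]

end ListElection

/-! ### Votes as lists of numbers -/

namespace ListElection

theorem before_of_append {x y : ℕ} {l l' : List ℕ} (hx : x ∉ l) (hy : y ∉ l) :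
    before (l ++ x :: l') x y = true := by
  have : l.filter (fun a => decide (a = x) || decide (a = y)) = [] := by
    rw [List.filter_eq_nil_iff]
    intro a ha
    simp only [Bool.or_eq_true, decide_eq_true_eq, not_or]
    exact ⟨fun h => hx (h ▸ ha), fun h => hy (h ▸ ha)⟩
  simp [before, List.filter_append, this]

theorem before_of_append' {x y : ℕ} {l l' : List ℕ} (hx : x ∉ l) (hy : y ∉ l) (hxy : x ≠ y) :
    before (l ++ x :: l') y x = false := by
  have : l.filter (fun a => decide (a = y) || decide (a = x)) = [] := by
    rw [List.filter_eq_nil_iff]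
    intro a ha
    simp only [Bool.or_eq_true, decide_eq_true_eq, not_or]
    exact ⟨fun h => hy (h ▸ ha), fun h => hx (h ▸ ha)⟩
  simp [before, List.filter_append, this, hxy]

end ListElection

open ListElection

/-- The list of the candidates, from the most to the least preferred one. -/
def Vote.toList {m : ℕ} (v : Vote m) : List ℕ := List.ofFn fun r => (v r : ℕ)

namespace Vote

variable {m : ℕ}

theorem length_toList (v : Vote m) : v.toList.length = m := by simp [toList]

theorem toList_injective : Function.Injective (toList (m := m)) := by
  intro v w h
  have := List.ofFn_injective h
  exact Equiv.ext fun r => Fin.ext (congrFun this r)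

theorem perm_toList (v : Vote m) : v.toList.Perm (List.range m) := by
  refine (List.perm_ext_iff_of_nodup ?_ List.nodup_range).2 fun a => ?_
  · exact List.nodup_ofFn.2 (Fin.val_injective.comp v.injective)
  · rw [toList, List.mem_ofFn, List.mem_range]
    exact ⟨fun ⟨r, hr⟩ => hr ▸ (v r).2, fun h => ⟨v.symm ⟨a, h⟩, by simp⟩⟩

/-- Cut the list at the rank of the preferred candidate: the entries in front of it have smaller
ranks, so neither candidate occurs there. -/
theorem before_toList (v : Vote m) {a b : Fin m} (hab : a ≠ b) :
    before v.toList a b = decide (v.Prefers a b) := by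
  have key : ∀ {a b : Fin m}, v.Prefers a b →
      ∃ l l' : List ℕ, v.toList = l ++ (a : ℕ) :: l' ∧ (a : ℕ) ∉ l ∧ (b : ℕ) ∉ l := by
    intro a b h
    have hi : (v.symm a : ℕ) < v.toList.length := by rw [length_toList]; exact (v.symm a).2
    have hmem : ∀ c : Fin m, v.symm a ≤ v.symm c → (c : ℕ) ∉ v.toList.take (v.symm a) := by
      intro c hc hmem
      obtain ⟨j, hj, hjc⟩ := List.mem_take_iff_getElem.1 hmem
      rw [length_toList] at hj
      have hjm : j < m := lt_of_lt_of_le hj (min_le_right _ _)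
      simp only [toList, List.getElem_ofFn] at hjc
      have : v.symm c = ⟨j, hjm⟩ := by rw [Equiv.symm_apply_eq]; exact (Fin.ext hjc).symm
      rw [this, Fin.le_def] at hc
      have := lt_of_lt_of_le hj (min_le_left _ _)
      simp only at hc
      omega
    refine ⟨v.toList.take (v.symm a), v.toList.drop (v.symm a + 1), ?_, hmem a le_rfl,
      hmem b (le_of_lt h)⟩
    have h₁ : v.toList[(v.symm a : ℕ)] = a := by simp [toList]
    conv_lhs => rw [← List.take_append_drop (v.symm a : ℕ) v.toList, List.drop_eq_getElem_cons hi, h₁]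
  by_cases h : v.Prefers a b
  · obtain ⟨l, l', e, ha, hb⟩ := key h
    rw [e, before_of_append ha hb, decide_eq_true h]
  · have h' : v.Prefers b a :=
      lt_of_le_of_ne (not_lt.1 h) fun e => hab (v.symm.injective e).symm
    obtain ⟨l, l', e, hb, ha⟩ := key h'
    rw [e, before_of_append' hb ha fun e => hab (Fin.ext e).symm, decide_eq_false h]

/-- The vote given by a list. -/
noncomputable def ofList (m : ℕ) (l : List ℕ) : Vote m :=
  open Classical in
  if h : l.Perm (List.range m) then
    Equiv.ofBijective (fun r => ⟨l[r]'(by rw [h.length_eq, List.length_range]; exact r.2),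
      List.mem_range.1 (h.mem_iff.1 (List.getElem_mem _))⟩) (by
        rw [← Finite.injective_iff_bijective]
        intro r s hrs
        have hn : l.Nodup := h.nodup_iff.2 List.nodup_range
        exact Fin.ext (hn.getElem_inj_iff.1 (Fin.mk.inj hrs)))
  else Equiv.refl _

theorem toList_ofList {l : List ℕ} (h : l.Perm (List.range m)) : (ofList m l).toList = l := by
  have hl : l.length = m := by rw [h.length_eq, List.length_range]
  refine List.ext_getElem (by simp [length_toList, hl]) fun i h₁ h₂ => ?_
  simp [toList, ofList, h]

theorem prefers_comm (v : Vote m) {a b : Fin m} (hab : a ≠ b) : v.Prefers b a ↔ ¬ v.Prefers a b := by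
  unfold Prefers
  rw [not_lt]
  exact ⟨le_of_lt, fun h => lt_of_le_of_ne h fun e => hab (v.symm.injective e).symm⟩

/-- The vote `v` with `c` moved to the top. -/
def raise (v : Vote m) (c : Fin m) : Vote m :=
  (Fin.cycleRange (v.symm c)).symm.trans v

theorem raise_symm (v : Vote m) (c a : Fin m) :
    (v.raise c).symm a = Fin.cycleRange (v.symm c) (v.symm a) := rfl

theorem raise_prefers_self (v : Vote m) {c z : Fin m} (h : z ≠ c) : (v.raise c).Prefers c z := by
  have : NeZero m := ⟨fun h => by subst h; exact c.elim0⟩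
  unfold Prefers
  rw [raise_symm, raise_symm, Fin.cycleRange_self]
  refine Fin.pos_iff_ne_zero.2 fun e => h ?_
  rw [← Fin.cycleRange_self (v.symm c)] at e
  exact v.symm.injective ((Fin.cycleRange _).injective e)

/-- The cycle moves the candidates ranked above `c` down by one place and fixes those below, so the
order among candidates other than `c` survives. -/
theorem raise_prefers_iff (v : Vote m) {c x y : Fin m} (hx : x ≠ c) (hy : y ≠ c) :
    (v.raise c).Prefers x y ↔ v.Prefers x y := by
  have key : ∀ x : Fin m, x ≠ c → ((v.raise c).symm x : ℕ) =
      if v.symm x < v.symm c then (v.symm x : ℕ) + 1 else v.symm x := by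
    intro x hx
    rw [raise_symm]
    split
    · exact Fin.coe_cycleRange_of_lt ‹_›
    · rw [Fin.cycleRange_of_gt]
      exact lt_of_le_of_ne (not_lt.1 ‹_›) fun e => hx (v.symm.injective e).symm
  have hx' : (v.symm x : ℕ) ≠ v.symm c := fun e => hx (v.symm.injective (Fin.ext e))
  have hy' : (v.symm y : ℕ) ≠ v.symm c := fun e => hy (v.symm.injective (Fin.ext e))
  unfold Prefers
  rw [Fin.lt_def, key x hx, key y hy]
  simp only [Fin.lt_def]
  split <;> split <;> omega

end Vote

/-! ### Margins, winners, and moving a candidate to the top -/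

namespace Profile

variable {m : ℕ}

theorem support_append (P Q : Profile m) (a b : Fin m) :
    Profile.support (P ++ Q) a b = P.support a b + Q.support a b :=
  List.countP_append

theorem margin_append (P Q : Profile m) (a b : Fin m) :
    Profile.margin (P ++ Q) a b = P.margin a b + Q.margin a b := by
  unfold margin
  rw [support_append, support_append]
  push_cast
  ring

theorem support_add_support (P : Profile m) {a b : Fin m} (hab : a ≠ b) :
    P.support a b + P.support b a = P.length := by
  rw [List.length_eq_countP_add_countP fun v => decide (Vote.Prefers v a b)]
  unfold support
  congr 1
  refine List.countP_congr fun v _ => ?_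
  simp [Vote.prefers_comm v hab]

theorem margin_eq (P : Profile m) {a b : Fin m} (hab : a ≠ b) :
    P.margin a b = 2 * P.support a b - P.length := by
  unfold margin
  rw [← P.support_add_support hab]
  push_cast
  ring

theorem margin_antisymm (P : Profile m) (a b : Fin m) : P.margin b a = -P.margin a b := by
  unfold margin; ring

theorem abs_margin_le (P : Profile m) (a b : Fin m) : |P.margin a b| ≤ P.length := by
  have h₁ : P.support a b ≤ P.length := List.countP_le_length
  have h₂ : P.support b a ≤ P.length := List.countP_le_length
  unfold margin
  rw [abs_le]
  omega

theorem supp_map_toList (P : Profile m) {a b : Fin m} (hab : a ≠ b) :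
    supp (P.map Vote.toList) a b = P.support a b := by
  unfold supp support
  rw [List.countP_map]
  refine List.countP_congr fun v _ => ?_
  simp [Vote.before_toList v hab]

theorem maximinWinners_eq_singleton_iff (P : Profile m) (c : Fin m) :
    P.maximinWinners = {c} ↔ ∀ x, x ≠ c → P.maximinScore x < P.maximinScore c := by
  constructor
  · intro h x hx
    have hc : c ∈ P.maximinWinners := h ▸ Set.mem_singleton c
    by_contra hlt
    refine hx (h ▸ (show x ∈ P.maximinWinners from fun b => ?_) : x ∈ ({c} : Set (Fin m)))
    exact (hc b).trans (not_lt.1 hlt)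
  · intro h
    ext x
    rw [Set.mem_singleton_iff]
    constructor
    · intro hx
      by_contra hne
      exact absurd (hx c) (not_le.2 (h x hne))
    · rintro rfl b
      rcases eq_or_ne b x with rfl | hb
      · exact le_rfl
      · exact (h b hb).le

/-- All votes, with `c` moved to the top. -/
def raise (W : Profile m) (c : Fin m) : Profile m := W.map fun v => Vote.raise v c

theorem margin_raise_self (W : Profile m) {c z : Fin m} (h : z ≠ c) :
    (W.raise c).margin c z = W.length := by
  rw [margin_eq _ h.symm]
  have : (W.raise c).support c z = (W.raise c).length := by
    refine List.countP_eq_length.2 fun v hv => ?_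
    obtain ⟨w, _, rfl⟩ := List.mem_map.1 hv
    exact decide_eq_true (w.raise_prefers_self h)
  rw [this, raise, List.length_map]
  ring

/-- Comparisons that avoid `c` are unchanged, and `x` now loses to `c` in every vote. -/
theorem margin_raise_le (W : Profile m) {c x y : Fin m} (hx : x ≠ c) (hxy : y ≠ x) :
    (W.raise c).margin x y ≤ W.margin x y := by
  have h : (W.raise c).support x y ≤ W.support x y := by
    unfold support raise
    rw [List.countP_map]
    refine List.countP_mono_left fun v _ hv => ?_
    simp only [Function.comp_apply, decide_eq_true_eq] at hv ⊢
    rcases eq_or_ne y c with rfl | hy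
    · exact absurd hv ((Vote.prefers_comm _ hxy.symm).1 (v.raise_prefers_self hx))
    · exact (v.raise_prefers_iff hx hy).1 hv
  rw [margin_eq _ hxy.symm, margin_eq _ hxy.symm, raise, List.length_map]
  unfold raise at h
  omega

end Profile

/-! ### The manipulators' problem in terms of margins -/

namespace CMInstance

/-- If `s` is the maximin score of the distinguished candidate among the non-manipulators, then
the manipulators succeed iff they can push every other candidate below `s + |M|`. -/
theorem isYes_iff_of_score {m : ℕ} {c : Fin m} {P : Profile m} {M : ℕ} (hM : 0 < M) (s : ℤ)
    {z₀ : Fin m} (hz₀ : z₀ ≠ c) (hs : P.margin c z₀ = s) (hmin : ∀ z, z ≠ c → s ≤ P.margin c z) :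
    (mk m c P M hM).IsYes ↔ ∃ W : Profile m, W.length = M ∧ ∀ x, x ≠ c → ∃ y, y ≠ x ∧
      P.margin x y + W.margin x y < s + M := by
  change (∃ W : Profile m, W.length = M ∧ Profile.maximinWinners (P ++ W) = {c}) ↔ _
  constructor
  · rintro ⟨W, hW, hwin⟩
    refine ⟨W, hW, fun x hx => ?_⟩
    have h := (Profile.maximinWinners_eq_singleton_iff _ _).1 hwin x hx
    obtain ⟨y, hy, hlt⟩ := Finset.inf_lt_iff.1 h
    have h' := hlt.trans_le (Finset.inf_le (Finset.mem_erase.2 ⟨hz₀, Finset.mem_univ _⟩))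
    rw [WithTop.coe_lt_coe, Profile.margin_append, Profile.margin_append, hs] at h'
    refine ⟨y, (Finset.mem_erase.1 hy).1, h'.trans_le ?_⟩
    have := (abs_le.1 (W.abs_margin_le c z₀)).2
    rw [hW] at this
    omega
  · rintro ⟨W, hW, h⟩
    -- After the raise all margins of `c` are at least `s + M`, while the witnesses `y` for the
    -- other candidates remain valid.
    refine ⟨W.raise c, by rw [Profile.raise, List.length_map, hW], ?_⟩
    refine (Profile.maximinWinners_eq_singleton_iff _ _).2 fun x hx => ?_
    obtain ⟨y, hy, hlt⟩ := h x hx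
    refine lt_of_le_of_lt (Finset.inf_le (Finset.mem_erase.2 ⟨hy, Finset.mem_univ _⟩))
      (lt_of_lt_of_le (b := ((s + M : ℤ) : WithTop ℤ)) ?_ (Finset.le_inf fun z hz => ?_))
    · rw [WithTop.coe_lt_coe, Profile.margin_append]
      have := W.margin_raise_le hx hy
      omega
    · have hz' := (Finset.mem_erase.1 hz).1
      rw [WithTop.coe_le_coe, Profile.margin_append, W.margin_raise_self hz', hW]
      have := hmin z hz'
      omega

/-- An instance in which the distinguished candidate starts with a score above `-|M|` is
positive. -/
theorem isYes_of_forall_margin {m : ℕ} {c : Fin m} {P : Profile m} {M : ℕ} (hM : 0 < M)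
    (h : ∀ z, z ≠ c → 0 < P.margin c z + M) : (mk m c P M hM).IsYes := by
  change ∃ W : Profile m, W.length = M ∧ Profile.maximinWinners (P ++ W) = {c}
  let W : Profile m := Profile.raise (List.replicate M (Equiv.refl _)) c
  have hW : ∀ z, z ≠ c → W.margin c z = M := fun z hz => by
    rw [Profile.margin_raise_self _ hz, List.length_replicate]
  refine ⟨W, by simp [W, Profile.raise], ?_⟩
  refine (Profile.maximinWinners_eq_singleton_iff _ _).2 fun x hx => ?_
  refine lt_of_le_of_lt (Finset.inf_le (Finset.mem_erase.2 ⟨hx.symm, Finset.mem_univ _⟩))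
    -- Zero separates the scores: with `c` on top of all manipulators' votes, `c` beats everybody,
    -- so every other candidate has a negative margin against `c`.
    (lt_of_lt_of_le (b := ((0 : ℤ) : WithTop ℤ)) ?_ (Finset.le_inf fun z hz => ?_))
  · rw [WithTop.coe_lt_coe, Profile.margin_append, Profile.margin_antisymm,
      Profile.margin_antisymm W, hW x hx]
    have := h x hx
    omega
  · have hz' := (Finset.mem_erase.1 hz).1
    rw [WithTop.coe_le_coe, Profile.margin_append, hW z hz']
    exact (h z hz').le

end CMInstance

/-! ### Correctness of the reduction -/

namespace ListElection

/-- The margin of `x` over `y`. -/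
def lmargin (P : List (List ℕ)) (x y : ℕ) : ℤ := supp P x y - supp P y x

theorem lmargin_append (P Q : List (List ℕ)) (x y : ℕ) :
    lmargin (P ++ Q) x y = lmargin P x y + lmargin Q x y := by
  unfold lmargin supp
  rw [List.countP_append, List.countP_append]
  push_cast
  ring

theorem lmargin_flatMap {α : Type} (l : List α) (g : α → List (List ℕ)) (x y : ℕ) :
    lmargin (l.flatMap g) x y = (l.map fun a => lmargin (g a) x y).sum := by
  induction l with
  | nil => rfl
  | cons a l ih => rw [List.flatMap_cons, lmargin_append, ih, List.map_cons, List.sum_cons]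

theorem lmargin_antisymm (P : List (List ℕ)) (x y : ℕ) : lmargin P y x = -lmargin P x y := by
  unfold lmargin; ring

theorem sum_map_range (f : ℕ → ℤ) (n : ℕ) :
    ((List.range n).map f).sum = ∑ i ∈ Finset.range n, f i := by
  induction n with
  | zero => rfl
  | succ n ih => simp [List.range_succ, Finset.sum_range_succ, ih]

/-! ### McGarvey's construction with lists -/

theorem mem_others {m x y a : ℕ} : a ∈ others m x y ↔ a < m ∧ a ≠ x ∧ a ≠ y := by
  simp [others]

theorem nodup_others (m x y : ℕ) : (others m x y).Nodup := List.nodup_range.filter _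

theorem perm_of_mem_votePair {m x y : ℕ} (hx : x < m) (hy : y < m) (hxy : x ≠ y) {l : List ℕ}
    (hl : l ∈ votePair m x y) : l.Perm (List.range m) := by
  have h : (x :: y :: others m x y).Perm (List.range m) := by
    refine (List.perm_ext_iff_of_nodup ?_ List.nodup_range).2 fun a => ?_
    · simp [mem_others, hxy, nodup_others]
    · simp only [List.mem_cons, mem_others, List.mem_range]
      constructor
      · rintro (rfl | rfl | h) <;> [exact hx; exact hy; exact h.1]
      · intro h
        tauto
  simp only [votePair, List.mem_cons, List.not_mem_nil, or_false] at hl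
  rcases hl with rfl | rfl
  · exact h
  · exact (List.perm_append_comm.trans ((List.reverse_perm _).append_left [x, y])).trans h

/-- A list without repetitions contains two of its members in one of the two orders. -/
theorem filter_pair {l : List ℕ} (hl : l.Nodup) {p q : ℕ} (hp : p ∈ l) (hq : q ∈ l) (hpq : p ≠ q) :
    l.filter (fun a => decide (a = p) || decide (a = q)) = [p, q] ∨
      l.filter (fun a => decide (a = p) || decide (a = q)) = [q, p] := by
  have h : (l.filter fun a => decide (a = p) || decide (a = q)).Perm [p, q] := by
    refine (List.perm_ext_iff_of_nodup (hl.filter _) (by simp [hpq])).2 fun a => ?_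
    simp only [List.mem_filter, Bool.or_eq_true, decide_eq_true_eq, List.mem_cons,
      List.not_mem_nil, or_false]
    constructor
    · exact fun h => h.2
    · rintro (rfl | rfl) <;> simp [hp, hq]
  have hlen := h.length_eq
  generalize (l.filter fun a => decide (a = p) || decide (a = q)) = k at h hlen
  match k, hlen with
  | [a, b], _ =>
    have ha : a = p ∨ a = q := by simpa using h.mem_iff.1 (List.mem_cons_self (a := a))
    have hb : b = p ∨ b = q := by simpa using h.mem_iff.1 (show b ∈ [a, b] by simp)
    have hab : a ≠ b := by simpa using h.nodup_iff.2 (by simp [hpq])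
    rcases ha with rfl | rfl <;> rcases hb with rfl | rfl <;> simp_all

theorem filter_single {l : List ℕ} (hl : l.Nodup) {p q : ℕ} (hp : p ∉ l) (hq : q ∈ l) :
    l.filter (fun a => decide (a = p) || decide (a = q)) = [q] ∧
      l.filter (fun a => decide (a = q) || decide (a = p)) = [q] := by
  have key : ∀ f : ℕ → Bool, (∀ a ∈ l, f a = true ↔ a = q) → l.filter f = [q] := by
    intro f hf
    refine List.perm_singleton.1 ((List.perm_ext_iff_of_nodup (hl.filter _) (by simp)).2 fun a => ?_)
    rw [List.mem_filter, List.mem_singleton]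
    exact ⟨fun h => (hf a h.1).1 h.2, fun h => ⟨h ▸ hq, (hf a (h ▸ hq)).2 h⟩⟩
  constructor <;> refine key _ fun a ha => ?_
  · simp only [Bool.or_eq_true, decide_eq_true_eq, or_iff_right_iff_imp]
    exact fun h => absurd (h ▸ ha) hp
  · simp only [Bool.or_eq_true, decide_eq_true_eq, or_iff_left_iff_imp]
    exact fun h => absurd (h ▸ ha) hp

theorem lmargin_pair (l k : List ℕ) (x y : ℕ) : lmargin [l, k] x y =
    ((before l x y).toNat : ℤ) + (before k x y).toNat - (before l y x).toNat
      - (before k y x).toNat := by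
  have : ∀ x y, supp [l, k] x y = (before l x y).toNat + (before k x y).toNat := by
    intro x y
    unfold supp
    cases h₁ : before l x y <;> cases h₂ : before k x y <;> simp [h₁, h₂]
  unfold lmargin
  rw [this, this]
  push_cast
  ring

theorem lmargin_votePair_self {m x y : ℕ} (hxy : x ≠ y) : lmargin (votePair m x y) x y = 2 := by
  have h : ∀ l : List ℕ, l = others m x y ∨ l = (others m x y).reverse → x ∉ l ∧ y ∉ l := by
    rintro l (rfl | rfl) <;> simp [mem_others]
  have h₁ : before (x :: y :: others m x y) x y = true :=
    before_of_append (l := []) (by simp) (by simp)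
  have h₂ : before (x :: y :: others m x y) y x = false :=
    before_of_append' (l := []) (by simp) (by simp) hxy
  rw [votePair, lmargin_pair, h₁, h₂,
    before_of_append (h _ (.inr rfl)).1 (h _ (.inr rfl)).2,
    before_of_append' (h _ (.inr rfl)).1 (h _ (.inr rfl)).2 hxy]
  norm_num

/-- Up to the order of `x` and `y`, the two votes are reverses of each other, so every other
comparison cancels. With exactly one of `p`, `q` in `{x, y}`, that one comes first in one vote and
last in the other; with both outside, the reversed block of the others cancels itself. -/
theorem lmargin_votePair_eq_zero {m x y p q : ℕ} (hx : x < m) (hy : y < m) (hxy : x ≠ y) (hp : p < m)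
    (hq : q < m) (hpq : p ≠ q) (h₁ : ¬ (x = p ∧ y = q)) (h₂ : ¬ (x = q ∧ y = p)) :
    lmargin (votePair m x y) p q = 0 := by
  have hyx := hxy.symm
  have hqp := hpq.symm
  have key : ∀ {p q}, p < m → q < m → p ≠ q → q ≠ x → q ≠ y → p = x ∨ p = y →
      lmargin (votePair m x y) p q = 0 := by
    intro p q hp hq hpq hqx hqy h
    have hq' : q ∈ others m x y := mem_others.2 ⟨hq, hqx, hqy⟩
    have hp' : p ∉ others m x y := fun h' => by have := mem_others.1 h'; omega
    obtain ⟨e₁, e₂⟩ := filter_single (nodup_others m x y) hp' hq'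
    obtain ⟨e₃, e₄⟩ := filter_single (List.nodup_reverse.2 (nodup_others m x y))
      (fun h => hp' (List.mem_reverse.1 h)) (List.mem_reverse.2 hq')
    have hqp := hpq.symm
    rw [votePair, lmargin_pair]
    rcases h with rfl | rfl <;>
      simp [before, List.filter_append, e₁, e₂, e₃, e₄, hqp, hpq, hxy, hyx,
        hqx.symm, hqy.symm, -List.filter_reverse]
  rcases em (p = x ∨ p = y) with hpe | hpe
  · exact key hp hq hpq (by omega) (by omega) hpe
  rcases em (q = x ∨ q = y) with hqe | hqe
  · rw [lmargin_antisymm, key hq hp hpq.symm (by omega) (by omega) hqe, neg_zero]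
  · have hp' : p ∈ others m x y := mem_others.2 ⟨hp, by omega, by omega⟩
    have hq' : q ∈ others m x y := mem_others.2 ⟨hq, by omega, by omega⟩
    have e : (others m x y).filter (fun a => decide (a = q) || decide (a = p)) =
        (others m x y).filter (fun a => decide (a = p) || decide (a = q)) := by
      simp only [Bool.or_comm]
    have hxp : x ≠ p := by omega
    have hyp : y ≠ p := by omega
    have hxq : x ≠ q := by omega
    have hyq : y ≠ q := by omega
    rw [votePair, lmargin_pair]
    rcases filter_pair (nodup_others m x y) hp' hq' hpq with h | h <;>
      simp [before, List.filter_append, List.filter_reverse, e, h, hqp, hpq,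
        hxp, hyp, hxq, hyq]

theorem lmargin_votePair {m x y p q : ℕ} (hx : x < m) (hy : y < m) (hxy : x ≠ y) (hp : p < m)
    (hq : q < m) (hpq : p ≠ q) : lmargin (votePair m x y) p q =
      (if x = p then if y = q then 2 else 0 else 0) - if x = q then if y = p then 2 else 0 else 0 := by
  by_cases h₁ : x = p ∧ y = q
  · obtain ⟨rfl, rfl⟩ := h₁
    rw [lmargin_votePair_self hxy]
    simp [hxy]
  by_cases h₂ : x = q ∧ y = p
  · obtain ⟨rfl, rfl⟩ := h₂
    rw [lmargin_antisymm, lmargin_votePair_self hxy]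
    simp [hxy]
  · rw [lmargin_votePair_eq_zero hx hy hxy hp hq hpq h₁ h₂]
    split_ifs <;> tauto

/-- Keeps `votePair m x x`, whose lists repeat `x` and are not votes, out of the reduced profile. -/
theorem copies_self (ν w M : ℕ) (P : List (List ℕ)) (x : ℕ) : copies ν w M P x x = 0 := by
  simp [copies]

/-- The profile that consists of the list of all candidates in increasing order. -/
theorem lmargin_range {m x y : ℕ} (hx : x < m) (hy : y < m) (hxy : x ≠ y) :
    lmargin [List.range m] x y = if x < y then 1 else -1 := by
  have h : [List.range m] = ([(Equiv.refl (Fin m) : Vote m)] : Profile m).map Vote.toList := by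
    rw [List.map_cons, List.map_nil]
    congr 1
    exact List.ext_getElem (by simp [Vote.length_toList]) fun i h₁ h₂ => by simp [Vote.toList]
  have key : ∀ {x y : ℕ}, x < m → y < m → x ≠ y →
      supp [List.range m] x y = if x < y then 1 else 0 := by
    intro x y hx hy hxy
    rw [h]
    have := Profile.supp_map_toList ([(Equiv.refl (Fin m) : Vote m)] : Profile m)
      (a := ⟨x, hx⟩) (b := ⟨y, hy⟩) (fun e => hxy (Fin.mk.inj e))
    refine this.trans ?_
    simp [Profile.support, Vote.Prefers, List.countP_cons]
  unfold lmargin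
  rw [key hx hy hxy, key hy hx hxy.symm]
  split_ifs <;> omega

theorem lmargin_reducedVotes {m ν w M : ℕ} (P : List (List ℕ)) {x y : ℕ} (hx : x < m) (hy : y < m)
    (hxy : x ≠ y) : lmargin (reducedVotes m ν w M P) x y =
      (if half w + half w = w then 0 else if x < y then 1 else -1) +
        (2 * copies ν w M P x y - 2 * copies ν w M P y x) := by
  unfold reducedVotes
  rw [lmargin_append]
  congr 1
  · by_cases h : half w + half w = w
    · rw [if_pos (decide_eq_true h), if_pos h]; rfl
    · rw [if_neg (by simpa using h), if_neg h, lmargin_range hx hy hxy]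
  · simp only [lmargin_flatMap, List.map_replicate, List.sum_replicate, nsmul_eq_mul, sum_map_range]
    -- Written as nested conditionals so that the double sum collapses to the two ordered pairs `(x,
    -- y)` and `(y, x)`.
    have h : ∀ a ∈ Finset.range m, ∀ b ∈ Finset.range m,
        (copies ν w M P a b : ℤ) * lmargin (votePair m a b) x y =
          (if a = x then if b = y then 2 * (copies ν w M P a b : ℤ) else 0 else 0) -
            if a = y then if b = x then 2 * (copies ν w M P a b : ℤ) else 0 else 0 := by
      intro a ha b hb
      by_cases hab : a = b
      · subst hab
        simp [copies_self]
      · rw [lmargin_votePair (Finset.mem_range.1 ha) (Finset.mem_range.1 hb) hab hx hy hxy]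
        split_ifs <;> ring
    rw [Finset.sum_congr rfl fun a ha => Finset.sum_congr rfl (h a ha)]
    simp [Finset.sum_sub_distrib, Finset.sum_ite_irrel, hx, hy]

/-! ### Halves and minima computed by counting -/

theorem countP_lt_range (n k : ℕ) :
    (List.range n).countP (fun t => decide (t < k)) = min n k := by
  induction n with
  | zero => simp
  | succ n ih =>
    rw [List.range_succ, List.countP_append, ih, List.countP_singleton]
    by_cases h : n < k
    · simp [h]; omega
    · simp [h]; omega

theorem half_eq (w : ℕ) : half w = (w + 1) / 2 := by
  unfold half
  rw [show (fun t => decide (t + t < w)) = fun t => decide (t < (w + 1) / 2) from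
    funext fun t => decide_eq_decide.2 (by omega), countP_lt_range]
  omega

/-- The minimum is the number of thresholds `t` that lie below all supports. Supports never exceed
the number of votes, so the cut-off there is harmless once there is a second candidate. -/
theorem minSupp_spec {m c z : ℕ} (P : List (List ℕ)) (hz : z < m) (hzc : z ≠ c) :
    (∀ z < m, z ≠ c → minSupp m c P ≤ supp P c z) ∧
      ∃ z < m, z ≠ c ∧ supp P c z = minSupp m c P := by
  obtain ⟨y, hy, hmin⟩ := Finset.exists_min_image ((Finset.range m).erase c) (supp P c)
    ⟨z, Finset.mem_erase.2 ⟨hzc, Finset.mem_range.2 hz⟩⟩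
  rw [Finset.mem_erase, Finset.mem_range] at hy
  have : minSupp m c P = supp P c y := by
    unfold minSupp
    rw [show (fun t => (List.range m).all fun z => decide (z = c) || decide (t < supp P c z)) =
      fun t => decide (t < supp P c y) from funext fun t => ?_, countP_lt_range]
    · exact min_eq_right List.countP_le_length
    · rw [Bool.eq_iff_iff]
      simp only [List.all_eq_true, List.mem_range, Bool.or_eq_true, decide_eq_true_eq]
      constructor
      · exact fun h => (h y hy.2).resolve_left hy.1
      · intro h z hz
        by_cases hzc : z = c
        · exact .inl hzc
        · exact .inr (h.trans_le (hmin z (Finset.mem_erase.2 ⟨hzc, Finset.mem_range.2 hz⟩)))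
  rw [this]
  exact ⟨fun z hz hzc => hmin z (Finset.mem_erase.2 ⟨hzc, Finset.mem_range.2 hz⟩), y, hy.2, hy.1, rfl⟩

/-! ### Truncation of the margins -/

section excess

variable {ν w M a b : ℕ}

/-- This is the antisymmetry of the new margins. If both supports are below `ν + M`, then `w < 2 *
M` and nothing is truncated (a support below `ν` would force the other one above `ν + w ≥ ν + M`).
If neither is, then `w ≥ 2 * M` and both values are `M + 1`. Otherwise one value is defined as the
complement of the other. -/
theorem excess_add_excess (h : a + b = w + 2 * ν) (hw : M ≤ w) :
    excess ν (min w (M + M)) M a b + excess ν (min w (M + M)) M b a = min w (M + M) + 2 := by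
  unfold excess
  simp only [decide_eq_true_eq]
  split_ifs <;> omega

/-- Below `ν` both inequalities hold for all admissible `d`, and from `ν + M` on both fail for all
of them; in between the value is exact. The shift by one in `excess` lets the natural number `0`
stand for "below `ν`", which must stay distinct from equality with `ν`: only the latter fails at `d
= M`. -/
theorem excess_lt_iff (h : a + b = w + 2 * ν) (hw : M ≤ w) {d : ℤ} (hd : |d| ≤ M) :
    2 * ((excess ν (min w (M + M)) M a b : ℤ) - 1) + d < M ↔ 2 * ((a : ℤ) - ν) + d < M := by
  rw [abs_le] at hd
  unfold excess
  simp only [decide_eq_true_eq]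
  split_ifs <;> omega

theorem excess_self (hM : 0 < M) : excess ν w M ν b = 1 := by
  unfold excess
  rw [if_pos (by simpa using hM)]
  omega

theorem one_le_excess (ha : ν ≤ a) (h : a + b = w + 2 * ν) (hw : M ≤ w) :
    1 ≤ excess ν (min w (M + M)) M a b := by
  unfold excess
  simp only [decide_eq_true_eq]
  split_ifs <;> omega

/-- The excess is at most `max M (w + 2)`, and `half w + 1` is the middle of the range up to `w +
2`, rounded up; the distance from it is at most `M + 1` because `w ≤ 2 * M`. -/
theorem copies_le {P : List (List ℕ)} (hw : w ≤ M + M) (x y : ℕ) : copies ν w M P x y ≤ M + 1 := by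
  unfold copies excess
  rw [half_eq]
  simp only [decide_eq_true_eq]
  split_ifs <;> omega

end excess

/-- With `w' = min w (M + M)` and `u` the excess, for `x < y` one has `2 * (u - 1) - w' = 2 * (u -
(half w' + 1))`, plus `1` if `w'` is odd; that unit comes from the increasing vote. The truncated
differences in `copies x y` and `copies y x` are the positive and negative parts of `u - (half w' +
1)`. The case `y < x` follows by antisymmetry. -/
theorem lmargin_reducedVotes_eq {m ν w M : ℕ} (P : List (List ℕ)) {x y : ℕ} (hx : x < m)
    (hy : y < m) (hxy : x ≠ y) (h : supp P x y + supp P y x = w + 2 * ν) (hw : M ≤ w) :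
    lmargin (reducedVotes m ν (min w (M + M)) M P) x y =
      2 * ((excess ν (min w (M + M)) M (supp P x y) (supp P y x) : ℤ) - 1) -
        (min w (M + M) : ℕ) := by
  rw [lmargin_reducedVotes P hx hy hxy]
  have h₁ := excess_add_excess h hw
  unfold copies
  rw [half_eq]
  simp only [decide_eq_true_eq]
  generalize min w (M + M) = w' at *
  generalize excess ν w' M (supp P x y) (supp P y x) = u at *
  generalize excess ν w' M (supp P y x) (supp P x y) = u' at *
  split_ifs <;> omega

theorem length_reducedVotes_le {m ν w M : ℕ} (P : List (List ℕ)) (hw : w ≤ M + M) :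
    (reducedVotes m ν w M P).length ≤ 1 + m * (m * ((M + 1) * 2)) := by
  unfold reducedVotes
  rw [List.length_append]
  refine Nat.add_le_add (by split <;> simp) ?_
  have key : ∀ (n B : ℕ) (g : ℕ → List (List ℕ)), (∀ a, (g a).length ≤ B) →
      ((List.range n).flatMap g).length ≤ n * B := by
    intro n B g hg
    induction n with
    | zero => simp
    | succ n ih =>
      rw [List.range_succ, List.flatMap_append, List.length_append, Nat.succ_mul]
      have := hg n
      simp only [List.flatMap_cons, List.flatMap_nil, List.append_nil]
      omega
  refine key _ _ _ fun x => key _ _ _ fun y => ?_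
  have : ((List.replicate (copies ν w M P x y) ()).flatMap fun _ => votePair m x y).length =
      copies ν w M P x y * 2 := by
    simp [List.length_flatMap, votePair]
  rw [this]
  exact Nat.mul_le_mul_right _ (copies_le hw x y)

theorem perm_of_mem_reducedVotes {m ν w M : ℕ} {P : List (List ℕ)} {l : List ℕ}
    (hl : l ∈ reducedVotes m ν w M P) : l.Perm (List.range m) := by
  unfold reducedVotes at hl
  rcases List.mem_append.1 hl with h | h
  · split at h
    · simp at h
    · rw [List.mem_singleton.1 h]
  · simp only [List.mem_flatMap, List.mem_range, List.mem_replicate] at h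
    obtain ⟨x, hx, y, hy, _, ⟨hne, _⟩, h⟩ := h
    refine perm_of_mem_votePair hx hy (fun e => hne ?_) h
    rw [e, copies_self]

theorem perm_of_mem_kernelVotes {m c M : ℕ} {P : List (List ℕ)} {l : List ℕ}
    (hl : l ∈ kernelVotes m c M P) : l.Perm (List.range m) := by
  unfold kernelVotes at hl
  split at hl
  · simp at hl
  · exact perm_of_mem_reducedVotes hl

theorem length_kernelVotes_le {m c M : ℕ} (P : List (List ℕ)) :
    (kernelVotes m c M P).length ≤ 1 + m * (m * ((M + 1) * 2)) := by
  unfold kernelVotes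
  split
  · simp
  · exact length_reducedVotes_le P (min_le_right _ _)

end ListElection

/-! ### Equivalence of an instance with its kernel, and the number of voters -/

namespace CMInstance

open ListElection

/-- The kernel of an instance. -/
noncomputable def kernel (I : CMInstance) : CMInstance where
  m := I.m
  c := I.c
  votes := (kernelVotes I.m I.c I.manip (I.votes.map Vote.toList)).map (Vote.ofList I.m)
  manip := I.manip
  manip_pos := I.manip_pos

theorem map_toList_kernel (I : CMInstance) : I.kernel.votes.map Vote.toList =
    kernelVotes I.m I.c I.manip (I.votes.map Vote.toList) := by
  change ((kernelVotes I.m I.c I.manip (I.votes.map Vote.toList)).map (Vote.ofList I.m)).map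
    Vote.toList = _
  rw [List.map_map]
  exact (List.map_congr_left fun l hl => Vote.toList_ofList (perm_of_mem_kernelVotes hl)).trans
    (List.map_id _)

theorem margin_eq_lmargin {m : ℕ} (P : Profile m) {a b : Fin m} (hab : a ≠ b) :
    P.margin a b = lmargin (P.map Vote.toList) a b := by
  unfold lmargin Profile.margin
  rw [← Profile.supp_map_toList _ hab, ← Profile.supp_map_toList _ hab.symm]

theorem isYes_iff_of_map_toList {m : ℕ} {c : Fin m} {P Q : Profile m} {M : ℕ} (hM : 0 < M)
    (hQ : Q.map Vote.toList = kernelVotes m c M (P.map Vote.toList)) :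
    (mk m c Q M hM).IsYes ↔ (mk m c P M hM).IsYes := by
  by_cases h₁ : ∃ z, z ≠ c
  · obtain ⟨z, hz⟩ := h₁
    have hsupp : ∀ {a b : Fin m}, a ≠ b → supp (P.map Vote.toList) a b = P.support a b :=
      fun hab => Profile.supp_map_toList _ hab
    have hlen : (P.map Vote.toList).length = P.length := List.length_map ..
    obtain ⟨hmin, z₀, hz₀, hz₀c, hz₀s⟩ :=
      minSupp_spec (P.map Vote.toList) z.2 fun e => hz (Fin.ext e)
    rw [kernelVotes, hlen] at hQ
    set ν := minSupp m c (P.map Vote.toList)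
    have hz₀' : (⟨z₀, hz₀⟩ : Fin m) ≠ c := fun e => hz₀c (congrArg Fin.val e)
    have hs₀ : P.support c ⟨z₀, hz₀⟩ = ν := by
      rw [← hsupp hz₀'.symm]; exact hz₀s
    have hs : ∀ y, y ≠ c → ν ≤ P.support c y := fun y hy => by
      rw [← hsupp hy.symm]; exact hmin y y.2 fun e => hy (Fin.ext e)
    have hcard := fun {a b : Fin m} (hab : a ≠ b) => P.support_add_support hab
    -- The score of `c` is `2 * ν - P.length`, so this says that it exceeds `-M`; truncated
    -- subtraction also covers a positive score.
    by_cases htriv : P.length - (ν + ν) < M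
    · rw [if_pos (decide_eq_true htriv)] at hQ
      obtain rfl : Q = [] := List.map_eq_nil_iff.1 hQ
      refine iff_of_true (isYes_of_forall_margin _ fun y hy => ?_)
        (isYes_of_forall_margin _ fun y hy => ?_)
      · simpa [Profile.margin, Profile.support] using hM
      · rw [Profile.margin_eq _ hy.symm]
        have := hs y hy
        omega
    · obtain ⟨w, hw⟩ : ∃ w, P.length = w + 2 * ν := ⟨P.length - 2 * ν, by omega⟩
      have hwM : M ≤ w := by omega
      rw [if_neg (by simpa using htriv), show P.length - (ν + ν) = w by omega] at hQ
      have hk : ∀ {a b : Fin m}, a ≠ b → Q.margin a b =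
          2 * ((excess ν (min w (M + M)) M (P.support a b) (P.support b a) : ℤ) - 1) -
            (min w (M + M) : ℕ) := by
        intro a b hab
        rw [margin_eq_lmargin _ hab, hQ,
          lmargin_reducedVotes_eq _ a.2 b.2 (fun e => hab (Fin.ext e)) _ hwM,
          hsupp hab, hsupp hab.symm]
        rw [hsupp hab, hsupp hab.symm, hcard hab, hw]
      rw [isYes_iff_of_score (P := P) hM (2 * ν - P.length) hz₀'
          (by rw [Profile.margin_eq _ hz₀'.symm, hs₀])
          (fun y hy => by rw [Profile.margin_eq _ hy.symm]; have := hs y hy; omega),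
        -- In the reduced election `c` has score `-min w (M + M)`, still attained against `z₀`.
        isYes_iff_of_score (P := Q) hM (-(min w (M + M) : ℕ)) hz₀' ?_ ?_]
      · refine exists_congr fun W => and_congr_right fun hW => forall_congr' fun x =>
          imp_congr_right fun _ => exists_congr fun y => and_congr_right fun hyx => ?_
        have hd := W.abs_margin_le x y
        rw [hW] at hd
        -- After subtracting the respective score of `c`, the two conditions on `W`, `x` and `y` are
        -- the two sides of this equivalence; so the same `W` and `y` serve both elections.
        have h₃ := excess_lt_iff ((hcard (Ne.symm hyx)).trans hw) hwM hd
        rw [hk (Ne.symm hyx), Profile.margin_eq P (Ne.symm hyx)]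
        constructor
        · intro h; have := h₃.1 (by linarith); linarith
        · intro h; have := h₃.2 (by linarith); linarith
      · rw [hk hz₀'.symm, hs₀, excess_self hM]
        ring
      · intro y hy
        rw [hk (Ne.symm hy)]
        have h₆ := one_le_excess (hs y hy) ((hcard (Ne.symm hy)).trans hw) hwM
        omega
  -- With `c` as the only candidate both instances are positive.
  · push Not at h₁
    exact iff_of_true (isYes_of_forall_margin _ fun z hz => absurd (h₁ z) hz)
      (isYes_of_forall_margin _ fun z hz => absurd (h₁ z) hz)

theorem isYes_kernel_iff (I : CMInstance) : I.kernel.IsYes ↔ I.IsYes :=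
  isYes_iff_of_map_toList I.manip_pos I.map_toList_kernel

theorem voters_kernel_le (I : CMInstance) : I.kernel.voters ≤ 6 * I.m ^ 2 * I.manip := by
  have h₁ : I.kernel.votes.length ≤ 1 + I.m * (I.m * ((I.manip + 1) * 2)) := by
    have := length_kernelVotes_le (m := I.m) (c := I.c) (M := I.manip) (I.votes.map Vote.toList)
    rw [← map_toList_kernel, List.length_map] at this
    exact this
  have hM := I.manip_pos
  have hm : 0 < I.m := I.c.pos
  have h₂ : 1 ≤ I.m ^ 2 := Nat.one_le_pow _ _ hm
  have h₃ : 1 ≤ I.m ^ 2 * I.manip := Nat.mul_pos h₂ hM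
  have h₄ : I.manip ≤ I.m ^ 2 * I.manip := Nat.le_mul_of_pos_left _ h₂
  have h₅ : I.m ^ 2 ≤ I.m ^ 2 * I.manip := Nat.le_mul_of_pos_right _ hM
  have h₆ : I.kernel.voters = I.kernel.votes.length + I.manip := rfl
  -- The total `1 + 2m²M + 2m² + M` has four terms, bounded by `1`, `2`, `2` and `1` times `m²M`.
  rw [h₆]
  nlinarith

end CMInstance

/-! ### Correctness of the algorithm -/

namespace ListElection

theorem unary_append (l k : List ℕ) : unary (l ++ k) = unary l ++ unary k := List.flatMap_append

theorem unary_cons (n : ℕ) (l : List ℕ) :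
    unary (n :: l) = List.replicate n true ++ [false] ++ unary l := rfl

theorem foldl_tokenStep_replicate (n k : ℕ) (l : List ℕ) :
    (List.replicate n true).foldl tokenStep (k, l) = (k + n, l) := by
  induction n generalizing k with
  | zero => rfl
  | succ n ih => rw [List.replicate_succ, List.foldl_cons, tokenStep, if_pos rfl, ih]; simp; omega

theorem foldl_tokenStep_unary (l k : List ℕ) :
    (unary l).foldl tokenStep (0, k) = (0, l.reverse ++ k) := by
  induction l generalizing k with
  | nil => rfl
  | cons n l ih =>
    rw [unary_cons, List.foldl_append, List.foldl_append, foldl_tokenStep_replicate]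
    change (unary l).foldl tokenStep (0, (0 + n) :: k) = _
    rw [ih]
    simp

theorem tokens_unary (l : List ℕ) : tokens (unary l) = (0, l.reverse) := by
  rw [tokens, foldl_tokenStep_unary, List.append_nil]

/-- Decoding loses nothing: a string with no trailing ones is the code of its tokens. This and the
analogous `flatten_blocks` show that the tests in `valid` accept only genuine codes. -/
theorem unary_tokens (x : List Bool) :
    unary (tokens x).2.reverse ++ List.replicate (tokens x).1 true = x := by
  induction x using List.reverseRecOn with
  | nil => rfl
  | append_singleton x b ih =>
    have h : tokens (x ++ [b]) = tokenStep (tokens x) b := by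
      simp [tokens, List.foldl_append]
    rw [h]
    conv_rhs => rw [← ih]
    cases b
    · simp [tokenStep, unary]
    · simp [tokenStep, List.replicate_succ']

theorem foldl_blockStep_block {m : ℕ} (v : List ℕ) : ∀ (u : List ℕ) (acc : List (List ℕ)), v ≠ [] →
    u.length + v.length = m → v.foldl (blockStep m) (u, acc) = ([], (u ++ v) :: acc) := by
  induction v with
  | nil => exact fun _ _ h => absurd rfl h
  | cons t v ih =>
    intro u acc _ hm
    rw [List.length_cons] at hm
    rw [List.foldl_cons]
    rcases eq_or_ne v [] with rfl | hv
    · rw [blockStep, if_pos (by simpa using hm)]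
      rfl
    · have hl := List.length_pos_iff.2 hv
      rw [blockStep, if_neg (by simp; omega), ih _ _ hv (by simp; omega)]
      simp

theorem foldl_blockStep_flatten {m : ℕ} (hm : 0 < m) (l : List (List ℕ)) (hl : ∀ v ∈ l, v.length = m)
    (acc : List (List ℕ)) : l.flatten.foldl (blockStep m) ([], acc) = ([], l.reverse ++ acc) := by
  induction l generalizing acc with
  | nil => rfl
  | cons v l ih =>
    have hv := hl v (by simp)
    rw [List.flatten_cons, List.foldl_append, foldl_blockStep_block v [] acc
      (fun h => by subst h; simp at hv; omega) (by simpa using hv), ih fun w hw => hl w (by simp [hw])]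
    simp

theorem blocks_flatten {m : ℕ} (hm : 0 < m) {l : List (List ℕ)} (hl : ∀ v ∈ l, v.length = m) :
    blocks m l.flatten = ([], l.reverse) := by
  rw [blocks, foldl_blockStep_flatten hm l hl, List.append_nil]

theorem flatten_blocks (m : ℕ) (l : List ℕ) :
    (blocks m l).2.reverse.flatten ++ (blocks m l).1 = l ∧ ∀ v ∈ (blocks m l).2, v.length = m := by
  induction l using List.reverseRecOn with
  | nil => exact ⟨rfl, by simp [blocks]⟩
  | append_singleton l t ih =>
    have h : blocks m (l ++ [t]) = blockStep m (blocks m l) t := by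
      simp [blocks, List.foldl_append]
    rw [h, blockStep]
    obtain ⟨h₁, h₂⟩ := ih
    split
    · rename_i hlen
      refine ⟨?_, ?_⟩
      · conv_rhs => rw [← h₁]
        simp
      · intro v hv
        rcases List.mem_cons.1 hv with rfl | hv
        · simpa using hlen
        · exact h₂ v hv
    · refine ⟨?_, h₂⟩
      conv_rhs => rw [← h₁]
      simp

end ListElection

/-! ### Codes of instances -/

namespace CMInstance

open ListElection

theorem encode_eq (I : CMInstance) : I.encode =
    unary ((I.m : ℕ) :: (I.c : ℕ) :: I.manip :: (I.votes.map Vote.toList).flatten) := by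
  have h : ∀ P : Profile I.m,
      (P.map encodeVote).flatten = unary (P.map Vote.toList).flatten := by
    intro P
    induction P with
    | nil => rfl
    | cons v P ih =>
      rw [List.map_cons, List.flatten_cons, ih, List.map_cons, List.flatten_cons, unary_append]
      congr 1
      simp [encodeVote, unary, Vote.toList, List.flatMap_def, List.map_ofFn, Function.comp_def,
        encodeNat]
  rw [encode, h, unary_cons, unary_cons, unary_cons]
  simp [encodeNat]

theorem tokens_encode (I : CMInstance) : tokens I.encode =
    (0, ((I.m : ℕ) :: (I.c : ℕ) :: I.manip :: (I.votes.map Vote.toList).flatten).reverse) := by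
  rw [encode_eq, tokens_unary]

theorem blocks_flatten_map_toList (I : CMInstance) :
    blocks I.m (I.votes.map Vote.toList).flatten = ([], (I.votes.map Vote.toList).reverse) :=
  blocks_flatten I.c.pos fun v hv => by
    obtain ⟨w, _, rfl⟩ := List.mem_map.1 hv
    exact w.length_toList

theorem parse_encode (I : CMInstance) :
    parse I.encode = (I.m, (I.c : ℕ), I.manip, I.votes.map Vote.toList) := by
  rw [parse, tokens_encode]
  simp only [List.reverse_reverse, List.tail_cons, List.headD_cons]
  rw [blocks_flatten_map_toList, List.reverse_reverse]

/-- `parse` recovers all data. Injectivity is needed because membership in `MaximinCM` only provides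
some positive instance with the given code. -/
theorem encode_injective : Function.Injective encode := by
  rintro ⟨m, c, P, M, hM⟩ ⟨m', c', P', M', hM'⟩ h
  have h' := congrArg parse h
  rw [parse_encode, parse_encode] at h'
  simp only [Prod.mk.injEq] at h'
  obtain ⟨rfl, hc, rfl, hP⟩ := h'
  obtain rfl := Fin.ext hc
  obtain rfl := List.map_injective_iff.2 Vote.toList_injective hP
  rfl

theorem valid_encode (I : CMInstance) (p : Polynomial ℕ) (h : I.manip ≤ p.eval I.m) :
    valid p (I.encode, I.m) = true := by
  simp only [valid, parse_encode, tokens_encode, Bool.and_eq_true, decide_eq_true_eq,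
    List.reverse_reverse, List.tail_cons, blocks_flatten_map_toList, List.isEmpty_nil,
    List.length_reverse, List.length_cons, List.all_eq_true, List.mem_range, List.any_eq_true,
    List.mem_map]
  refine ⟨⟨⟨⟨⟨⟨⟨trivial, by omega⟩, trivial⟩, I.c.2⟩, I.manip_pos⟩, h⟩, trivial⟩, ?_⟩
  rintro _ ⟨v, _, rfl⟩ i hi
  exact ⟨i, v.perm_toList.mem_iff.2 (List.mem_range.2 hi), rfl⟩

theorem exists_of_valid {p : Polynomial ℕ} {y : List Bool × ℕ} (h : valid p y = true) :
    ∃ I : CMInstance, y = (I.encode, I.m) ∧ I.manip ≤ p.eval I.m := by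
  obtain ⟨x, k⟩ := y
  simp only [valid, Bool.and_eq_true, decide_eq_true_eq, List.all_eq_true, List.mem_range,
    List.any_eq_true, List.isEmpty_iff] at h
  obtain ⟨⟨⟨⟨⟨⟨⟨h₀, h₁⟩, rfl⟩, hc⟩, hM⟩, hp⟩, hb⟩, hv⟩ := h
  have hx := unary_tokens x
  rw [h₀, List.replicate_zero, List.append_nil] at hx
  simp only [parse] at *
  rw [← List.length_reverse] at h₁
  generalize (tokens x).2.reverse = ts at *
  match ts, h₁ with
  | m :: c :: M :: body, _ =>
    simp only [List.headD_cons, List.tail_cons] at *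
    obtain ⟨hfl, hlen⟩ := flatten_blocks m body
    rw [hb, List.append_nil] at hfl
    have hperm : ∀ v ∈ (blocks m body).2.reverse, v.Perm (List.range m) := by
      intro v hvm
      have hsub : List.range m ⊆ v := fun i hi => by
        obtain ⟨a, ha, rfl⟩ := hv v hvm i (List.mem_range.1 hi)
        exact ha
      -- A block of length `m` containing all `m` candidates is a permutation of them, so no test
      -- for repetitions is needed.
      refine ((List.subperm_of_subset List.nodup_range hsub).perm_of_length_le ?_).symm
      rw [hlen v (List.mem_reverse.1 hvm), List.length_range]
    refine ⟨⟨m, ⟨c, hc⟩, (blocks m body).2.reverse.map (Vote.ofList m), M, hM⟩, ?_, hp⟩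
    rw [encode_eq]
    have e : ((blocks m body).2.reverse.map (Vote.ofList m)).map Vote.toList =
        (blocks m body).2.reverse := by
      rw [List.map_map]
      exact (List.map_congr_left fun v hvm => Vote.toList_ofList (hperm v hvm)).trans
        (List.map_id _)
    simp only [e, hfl, hx]

theorem kernelize_encode (I : CMInstance) (p : Polynomial ℕ) (h : I.manip ≤ p.eval I.m) :
    kernelize p (I.encode, I.m) = (I.kernel.encode, I.kernel.m) := by
  rw [kernelize, if_pos (I.valid_encode p h)]
  simp only [parse_encode]
  rw [encode_eq, map_toList_kernel]
  rfl

theorem mem_maximinCM_iff (I : CMInstance) (p : Polynomial ℕ) (h : I.manip ≤ p.eval I.m) :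
    (I.encode, I.m) ∈ MaximinCM p ↔ I.IsYes := by
  constructor
  · rintro ⟨J, hJ, _, hyes⟩
    obtain rfl := encode_injective (Prod.ext_iff.1 hJ).1
    exact hyes
  · exact fun hyes => ⟨I, rfl, h, hyes⟩

/-- The code of an instance has at least three tokens, the empty string none; so `([], 0)` is a safe
output for rejected inputs. -/
theorem nil_notMem_maximinCM (p : Polynomial ℕ) : (([], 0) : List Bool × ℕ) ∉ MaximinCM p := by
  rintro ⟨J, hJ, _⟩
  have h := congrArg (fun y => (tokens y.1).2.length) hJ
  simp only [tokens_encode] at h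
  simp [tokens] at h

theorem length_encode_le (I : CMInstance) :
    I.encode.length ≤ 2 * (I.m + 1) + I.manip + 1 + I.votes.length * (I.m * (I.m + 1)) := by
  have h₁ : ∀ v : Vote I.m, (encodeVote v).length ≤ I.m * (I.m + 1) := by
    intro v
    rw [encodeVote, List.length_flatten, List.map_ofFn, List.sum_ofFn]
    refine (Finset.sum_le_card_nsmul _ _ (I.m + 1) fun r _ => ?_).trans (by simp)
    simp only [Function.comp_apply, encodeNat, List.length_append, List.length_replicate,
      List.length_singleton]
    omega
  have h₂ : ∀ P : Profile I.m, (P.map encodeVote).flatten.length ≤ P.length * (I.m * (I.m + 1)) := by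
    intro P
    induction P with
    | nil => simp
    | cons v P ih =>
      rw [List.map_cons, List.flatten_cons, List.length_append, List.length_cons, Nat.succ_mul]
      have := h₁ v
      omega
  have h₃ := h₂ I.votes
  have h₄ := I.c.2
  simp only [encode, encodeNat, List.length_append, List.length_replicate, List.length_singleton]
  omega

end CMInstance

/-! ### The size bound and the kernelization -/

namespace ListElection

theorem primrec_eval (p : Polynomial ℕ) : Primrec fun n : ℕ => p.eval n := by
  induction p using Polynomial.induction_on' with
  | add p q hp hq => simpa using Primrec.nat_add.comp hp hq
  | monomial n c =>
    simp only [Polynomial.eval_monomial]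
    refine Primrec.nat_mul.comp (Primrec.const c) ?_
    induction n with
    | zero => simpa using Primrec.const 1
    | succ n ih => simpa [pow_succ] using Primrec.nat_mul.comp ih Primrec.id

/-- The bound on the size of the kernel. -/
noncomputable def sizeBound (p : Polynomial ℕ) : Polynomial ℕ :=
  2 * (.X + 1) + p + 1 + 6 * .X ^ 2 * p * (.X * (.X + 1))

/-- `valid` does not decide the problem, only whether the input codes an admissible instance;
negative instances fall into the first case. -/
theorem kernelize_eq_or (p : Polynomial ℕ) (y : List Bool × ℕ) :
    (∃ I : CMInstance, y = (I.encode, I.m) ∧ I.manip ≤ p.eval I.m ∧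
      kernelize p y = (I.kernel.encode, I.kernel.m)) ∨
    (y ∉ MaximinCM p ∧ kernelize p y = ([], 0)) := by
  by_cases h : valid p y = true
  · obtain ⟨I, rfl, hI⟩ := CMInstance.exists_of_valid h
    exact .inl ⟨I, rfl, hI, I.kernelize_encode p hI⟩
  · refine .inr ⟨?_, if_neg h⟩
    rintro ⟨I, rfl, hI, _⟩
    exact h (I.valid_encode p hI)

theorem isKernelization_kernelize (p : Polynomial ℕ) :
    IsKernelization (MaximinCM p) (kernelize p) fun k => (sizeBound p).eval k where
  polyTime := isPolyTime_kernelize p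
  equivalent y := by
    obtain ⟨I, rfl, hI, hk⟩ | ⟨hy, hk⟩ := kernelize_eq_or p y
    · rw [hk, I.mem_maximinCM_iff p hI, I.kernel.mem_maximinCM_iff p hI, I.isYes_kernel_iff]
    · rw [hk]
      exact iff_of_false hy (CMInstance.nil_notMem_maximinCM p)
  computable_size := (primrec_eval _).to_comp
  length_le y := by
    obtain ⟨I, rfl, hI, hk⟩ | ⟨_, hk⟩ := kernelize_eq_or p y
    · rw [hk]
      have h₁ : I.kernel.encode.length ≤ 2 * (I.m + 1) + I.manip + 1 +
          I.kernel.votes.length * (I.m * (I.m + 1)) := I.kernel.length_encode_le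
      have h₂ := I.voters_kernel_le
      have h₃ : I.kernel.votes.length ≤ 6 * I.m ^ 2 * p.eval I.m :=
        (Nat.le_add_right _ _).trans (h₂.trans (Nat.mul_le_mul_left _ hI))
      have h₄ := Nat.mul_le_mul_right (I.m * (I.m + 1)) h₃
      simp only [sizeBound, Polynomial.eval_add, Polynomial.eval_mul, Polynomial.eval_pow,
        Polynomial.eval_X, Polynomial.eval_one, Polynomial.eval_ofNat]
      omega
    · rw [hk]
      exact Nat.zero_le _
  param_le y := by
    obtain ⟨I, rfl, hI, hk⟩ | ⟨_, hk⟩ := kernelize_eq_or p y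
    · rw [hk]
      have h₆ : I.kernel.m = I.m := rfl
      simp only [h₆, sizeBound, Polynomial.eval_add, Polynomial.eval_mul, Polynomial.eval_pow,
        Polynomial.eval_X, Polynomial.eval_one, Polynomial.eval_ofNat]
      omega
    · rw [hk]
      exact Nat.zero_le _

end ListElection

/-- For every polynomial `p`, coalitional manipulation for maximin with at most `p m` manipulators
has a polynomial kernel in the number `m` of candidates, and the kernel of an instance has
`O(m ^ 2 * |M|)` voters, with an absolute constant, on no more candidates and with no more
manipulators. -/
theorem theorem7 :
    ∃ C : ℕ, ∀ p : Polynomial ℕ, ∃ f : List Bool × ℕ → List Bool × ℕ,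
      IsPolynomialKernelization (MaximinCM p) f ∧
      ∀ I : CMInstance, I.manip ≤ p.eval I.m →
        ∃ J : CMInstance, f (I.encode, I.m) = (J.encode, J.m) ∧
          J.manip ≤ p.eval J.m ∧ J.m ≤ I.m ∧ J.manip ≤ I.manip ∧
          J.voters ≤ C * I.m ^ 2 * I.manip :=
  ⟨6, fun p => ⟨ListElection.kernelize p,
    ⟨_, ListElection.isKernelization_kernelize p, ListElection.sizeBound p, fun _ => le_rfl⟩,
    fun I hI => ⟨I.kernel, I.kernelize_encode p hI, hI, le_rfl, le_rfl, I.voters_kernel_le⟩⟩⟩
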